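/- For a finite graph $G=(V,E)$ and a partition $\xi$ of $V$ (a boundary condition: vertices in the same class of $\xi$ are identified), the random-cluster distribution with parameters $p\in[0,1]$, $q\ge 1$ is the probability distribution on subsets $\omega\subseteq E$ with $$\pi_{G^\xi,p,q}(\omega)\ \propto\ p^{|\omega|}(1-p)^{|E|-|\omega|}q^{|\mathrm{Comp}(\omega;\xi)|},$$ where $\mathrm{Comp}(\omega;\xi)$ is the set of connected components of $(V,\omega)$ after this identification. Let $\Lambda_r=[-r/2,r/2]^d\cap\mathbb Z^d$, with the nearest-neighbor edges of $\mathbb Z^d$ between its points. Write $\pi_{\Lambda_r^{\mathbf 0}}$ for the distribution with no identification (free), and $\pi_{\Lambda_r^{\mathbf 1}}$ for the distribution in which all vertices of $\Lambda_r$ that have a neighbor in $\mathbb Z^d\setminus\Lambda_r$ are identified (wired). The random-cluster model on $\mathbb Z^d$ with parameters $p,q$ satisfies weak spatial mixing (WSM) if there is a constant $C>0$ such that for every $r\in\mathbb N$ $$\big\|\pi_{\Lambda_r^{\mathbf 1}}(\omega(\Lambda_{r/2})\in\cdot)-\pi_{\Lambda_r^{\mathbf 0}}(\omega(\Lambda_{r/2})\in\cdot)\big\|_{\mathrm{TV}}\le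 Ce^{-r/C},$$ where $\omega(\Lambda_{r/2})$ is the restriction of $\omega$ to the edges with both endpoints in $\Lambda_{r/2}$. The FK dynamics on $G=(V,E)$ is the discrete-time Markov chain on subsets of $E$ that at each step picks $e\in E$ uniformly at random and, from the current configuration $\omega$, moves to $\omega\cup\{e\}$ with probability $\frac{p}{q(1-p)+p}$ if $e$ is a bridge in $\omega\cup\{e\}$ and with probability $p$ otherwise, and to $\omega\setminus\{e\}$ with the remaining probability. Its mixing time $t_{\mathrm{mix}}$ is the least $t$ such that, from every initial configuration, the law of the chain at time $t$ is within total variation distance $1/4$ of $\pi_{G,p,q}$. **Theorem 1.1.** Let $d\ge 2$, $q\ge 1$ and $p\in[0,1]$ be such that the random-cluster model on $\mathbb Z^d$ satisfies WSM. Then the mixing time of the FK dynamics on the torus $\mathbb T_n=(\mathbb Z/n\mathbb Z)^d$ is $O(N\log N)$, where $N=n^d$ is the number of vertices: there is a constant $C=C(p,q,d)>0$ such that $t_{\mathrm{mix}}\le C\,N\log N$ for all $n\ge 2$. -/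

import Mathlib

open scoped BigOperators

noncomputable section

namespace FK

/-! Total variation distance and mixing times of finite Markov chains. -/

section Markov

variable {Ω : Type*} [Fintype Ω]

/-- Total variation distance between two distributions on a finite set. -/
def tvDist (μ ν : Ω → ℝ) : ℝ := (1 / 2) * ∑ x, |μ x - ν x|

/-- The (worst-case) mixing time of the chain with transition matrix `P` to the distribution `π`:
the least `t` such that, from every initial state `x`, the law `(P ^ t) x` of the chain at time `t`
is within total variation distance `ε` of `π` (it is `⊤` if there is no such `t`). -/
def mixingTime [DecidableEq Ω] (P : Matrix Ω Ω ℝ) (π : Ω → ℝ) (ε : ℝ) : ℕ∞ :=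
  sInf ((fun t : ℕ => (t : ℕ∞)) '' {t : ℕ | ∀ x : Ω, tvDist ((P ^ t) x) π ≤ ε})

end Markov

/-! The random-cluster model and the FK dynamics on a finite graph, with vertices identified
according to a partition `ξ` of the vertex set (`ξ = ⊥` means that nothing is identified). -/

section RandomCluster

variable {V : Type*} (G : SimpleGraph V)

/-- Configurations are sets of (open) edges. -/
abbrev Config : Type _ := Finset G.edgeSet

/-- The subgraph `(V, ω)`. -/
def openGraph (ω : Config G) : SimpleGraph V :=
  SimpleGraph.fromEdgeSet (Subtype.val '' (ω : Set G.edgeSet))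

/-- `|Comp(ω; ξ)|`: the number of connected components of `(V, ω)` after the vertices in each
class of `ξ` are identified. -/
def numComp (ξ : Setoid V) (ω : Config G) : ℕ :=
  Nat.card (Quotient ((openGraph G ω).reachableSetoid ⊔ ξ))

variable [Fintype V] [DecidableEq V] [DecidableRel G.Adj]

/-- The weight `p ^ |ω| (1 - p) ^ (|E| - |ω|) q ^ |Comp(ω; ξ)|`
(the subtraction is exact, as `ω ⊆ E`). -/
def rcWeight (ξ : Setoid V) (p q : ℝ) (ω : Config G) : ℝ :=
  p ^ ω.card * (1 - p) ^ (Fintype.card G.edgeSet - ω.card) * q ^ numComp G ξ ω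

/-- The random-cluster distribution with boundary condition `ξ`. -/
def rcDist (ξ : Setoid V) (p q : ℝ) (ω : Config G) : ℝ :=
  rcWeight G ξ p q ω / ∑ ω' : Config G, rcWeight G ξ p q ω'

/-- The law of the restriction `ω ∩ F` when `ω` has law `μ`. -/
def marginal (F : Finset G.edgeSet) (μ : Config G → ℝ) (η : Config G) : ℝ :=
  ∑ ω : Config G with ω ∩ F = η, μ ω

/-- The probability that the edge `e`, when updated, is included in the new configuration:
`p / (q (1 - p) + p)` if `e` is a bridge in `ω ∪ {e}`, and `p` otherwise. -/
def openProb (ξ : Setoid V) (p q : ℝ) (ω : Config G) (e : G.edgeSet) : ℝ :=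
  if numComp G ξ (ω.erase e) ≠ numComp G ξ (insert e ω) then p / (q * (1 - p) + p) else p

/-- The transition matrix of the (discrete-time) FK dynamics: a uniformly random edge `e` is
included with probability `openProb` and excluded otherwise. -/
def fkMatrix (ξ : Setoid V) (p q : ℝ) : Matrix (Config G) (Config G) ℝ :=
  Matrix.of fun ω ω' =>
    (1 / (Fintype.card G.edgeSet : ℝ)) * ∑ e : G.edgeSet,
      ((if ω' = insert e ω then openProb G ξ p q ω e else 0) +
        (if ω' = ω.erase e then 1 - openProb G ξ p q ω e else 0))

/-- The mixing time, at total variation distance `1 / 4`, of the FK dynamics. -/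
def fkMixingTime (ξ : Setoid V) (p q : ℝ) : ℕ∞ :=
  mixingTime (fkMatrix G ξ p q) (rcDist G ξ p q) (1 / 4)

end RandomCluster

/-! Boxes in the lattice, and weak spatial mixing. -/

section Lattice

/-- The nearest-neighbour graph of `ℤ ^ d`: two points are adjacent iff their `ℓ¹` distance
is `1`. -/
def lattice (d : ℕ) : SimpleGraph (Fin d → ℤ) where
  Adj x y := ∑ i, |x i - y i| = 1
  symm := ⟨fun x y h => by simpa only [abs_sub_comm] using h⟩
  loopless := ⟨fun x h => by simp at h⟩

/-- The box `[-ℓ/2, ℓ/2] ^ d ∩ ℤ ^ d`. -/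
def box (d : ℕ) (ℓ : ℝ) : Finset (Fin d → ℤ) :=
  Fintype.piFinset fun _ => Finset.Icc ⌈-(ℓ / 2)⌉ ⌊ℓ / 2⌋

theorem mem_box {d : ℕ} {ℓ : ℝ} {x : Fin d → ℤ} :
    x ∈ box d ℓ ↔ ∀ i, -(ℓ / 2) ≤ (x i : ℝ) ∧ (x i : ℝ) ≤ ℓ / 2 := by
  simp only [box, Fintype.mem_piFinset, Finset.mem_Icc, Int.ceil_le, Int.le_floor]

/-- The subgraph of the lattice induced by the box. -/
def boxGraph (d : ℕ) (ℓ : ℝ) : SimpleGraph (box d ℓ) :=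
  (lattice d).comap Subtype.val

instance (d : ℕ) (ℓ : ℝ) : DecidableRel (boxGraph d ℓ).Adj := Classical.decRel _

/-- The inner boundary of the box: its vertices that have a lattice neighbour outside it. -/
def innerBoundary (d : ℕ) (ℓ : ℝ) : Set (box d ℓ) :=
  {x | ∃ y, y ∉ box d ℓ ∧ (lattice d).Adj x y}

/-- The wired boundary condition: all vertices of the inner boundary are identified. -/
def wired (d : ℕ) (ℓ : ℝ) : Setoid (box d ℓ) where
  r x y := x = y ∨ (x ∈ innerBoundary d ℓ ∧ y ∈ innerBoundary d ℓ)
  iseqv :=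
    { refl := fun _ => Or.inl rfl
      symm := by
        rintro x y (h | ⟨hx, hy⟩)
        · exact Or.inl h.symm
        · exact Or.inr ⟨hy, hx⟩
      trans := by
        rintro x y z (rfl | ⟨hx, hy⟩) (rfl | ⟨hy', hz⟩)
        · exact Or.inl rfl
        · exact Or.inr ⟨hy', hz⟩
        · exact Or.inr ⟨hx, hy⟩
        · exact Or.inr ⟨hx, hz⟩ }

open scoped Classical in
/-- The edges of the box of side length `ℓ` that belong to the box of side length `m`. -/
def innerEdges (d : ℕ) (ℓ m : ℝ) : Finset (boxGraph d ℓ).edgeSet :=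
  Finset.univ.filter fun e => ∀ v ∈ (e : Sym2 (box d ℓ)), (v : Fin d → ℤ) ∈ box d m

/-- Weak spatial mixing of the random-cluster model on `ℤ ^ d` with parameters `p`, `q`: the
distributions on the box of side length `r` with wired and with free boundary condition have
marginals on the box of side length `r / 2` that are exponentially close. -/
def WeakSpatialMixing (d : ℕ) (p q : ℝ) : Prop :=
  ∃ C : ℝ, 0 < C ∧ ∀ r : ℕ,
    tvDist
      (marginal (boxGraph d r) (innerEdges d r (r / 2)) (rcDist (boxGraph d r) (wired d r) p q))
      (marginal (boxGraph d r) (innerEdges d r (r / 2)) (rcDist (boxGraph d r) ⊥ p q))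
    ≤ C * Real.exp (-(r / C))

/-- The discrete torus `(ℤ / n ℤ) ^ d`, with `x` and `x ± eᵢ` adjacent whenever they are
distinct. -/
def torus (d n : ℕ) : SimpleGraph (Fin d → ZMod n) :=
  SimpleGraph.circulantGraph (Set.range fun i : Fin d => Pi.single i (1 : ZMod n))

instance (d n : ℕ) : DecidableRel (torus d n).Adj := Classical.decRel _

end Lattice

end FK

end

open scoped BigOperators
set_option linter.unusedSectionVars false

noncomputable section

/-! For `q ≥ 1` the opening probability of an edge increases with the configuration. The chains from
the full and the empty configuration can therefore be coupled so as to stay ordered, with every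
other start between them, and total variation distance is at most twice the sum over edges of the
probability that these two extreme chains differ there (`heatBath_pow_sub_dotProduct_le`).

The heart is a recursion for this disagreement (`disagreement_add_le`). Put a box of side `r` around
an edge. If the extreme chains differ in the box at time `s`, which costs a factor `a_s` per edge of
the box, then a further factor `a_t` is paid for disagreement at the centre after `t` more steps. If
they agree in the box, both are squeezed between the wired and the free box dynamics with the same
start; averaging over a stationary configuration bounds this gap by the difference of the wired and
free equilibrium marginals, which weak spatial mixing makes exponentially small. Up to constants,
`a_{s+t} ≤ r^{2d} a_s a_t + exp(-r/C)`.

A fixed large box makes the disagreement small after boundedly many sweeps, uniformly in `n`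
(`exists_torus_disagreement_le`). Doubling the time with `r` proportional to `2^k` then gives decay
like `exp(-2^k)` (`torus_disagreement_pow_two_le`). Taking `2^k` of order `log N` brings it below
`1/(8|E|)` after `O(log N)` sweeps of `|E| = O(N)` steps; the boxes fit because `log N` is much
smaller than `n`.

No coupling is constructed: every comparison is an inequality for the transition operator acting on
observables. -/

namespace FK

/-! ### Monotone single-edge dynamics as operators on observables. -/

section HeatBath

variable {E : Type*} [DecidableEq E]

/-- The operator on observables that resamples the edge `e`, which becomes open with probability
`h ω e`. -/
def edgeUpdate (h : Finset E → E → ℝ) (e : E) : Module.End ℝ (Finset E → ℝ) where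
  toFun f ω := h ω e * f (insert e ω) + (1 - h ω e) * f (ω.erase e)
  map_add' f g := by ext ω; simp only [Pi.add_apply]; ring
  map_smul' c f := by ext ω; simp only [Pi.smul_apply, smul_eq_mul, RingHom.id_apply]; ring

/-- The opening probabilities `h` lie in `[0, 1]` and are increasing in the configuration. -/
structure IsMonotoneRate (h : Finset E → E → ℝ) : Prop where
  nonneg : ∀ ω e, 0 ≤ h ω e
  le_one : ∀ ω e, h ω e ≤ 1
  mono : ∀ e, Monotone fun ω => h ω e

/-- The indicator of the event that `e` is open. -/
def openInd (e : E) (ω : Finset E) : ℝ := if e ∈ ω then 1 else 0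

theorem edgeUpdate_apply (h : Finset E → E → ℝ) (e : E) (f : Finset E → ℝ) (ω : Finset E) :
    edgeUpdate h e f ω = h ω e * f (insert e ω) + (1 - h ω e) * f (ω.erase e) := rfl

theorem openInd_nonneg (e : E) (ω : Finset E) : 0 ≤ openInd e ω := by
  unfold openInd; split_ifs <;> norm_num

theorem openInd_le_one (e : E) (ω : Finset E) : openInd e ω ≤ 1 := by
  unfold openInd; split_ifs <;> norm_num

theorem openInd_mono (e : E) : Monotone (openInd e) := by
  intro ω ω' hω
  unfold openInd
  split_ifs with h1 h2 <;> first | exact absurd (hω h1) h2 | norm_num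

variable [Fintype E]

/-- The transition operator on observables of the chain that resamples a uniformly random edge. -/
def heatBath (h : Finset E → E → ℝ) : Module.End ℝ (Finset E → ℝ) :=
  (1 / (Fintype.card E : ℝ)) • ∑ e, edgeUpdate h e

/-- The chain `heatBath h`, run at speed `κ`. -/
def lazyHeatBath (κ : ℝ) (h : Finset E → E → ℝ) : Module.End ℝ (Finset E → ℝ) :=
  (1 - κ) • 1 + κ • heatBath h

/-- `μ` is a probability distribution that is stationary for the chain `heatBath h`. -/
structure IsStationary (h : Finset E → E → ℝ) (μ : Finset E → ℝ) : Prop where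
  nonneg : ∀ ω, 0 ≤ μ ω
  sum_eq_one : ∑ ω, μ ω = 1
  dotProduct_heatBath : ∀ f, μ ⬝ᵥ heatBath h f = μ ⬝ᵥ f

variable {h : Finset E → E → ℝ} {μ : Finset E → ℝ}

theorem heatBath_apply (f : Finset E → ℝ) (ω : Finset E) :
    heatBath h f ω = (1 / (Fintype.card E : ℝ)) * ∑ e, edgeUpdate h e f ω := by
  simp [heatBath, LinearMap.sum_apply, Finset.sum_apply]

theorem lazyHeatBath_apply (κ : ℝ) (f : Finset E → ℝ) (ω : Finset E) :
    lazyHeatBath κ h f ω = (1 - κ) * f ω + κ * heatBath h f ω := by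
  simp [lazyHeatBath]

theorem heatBath_mono (hh : IsMonotoneRate h) {f g : Finset E → ℝ} (hfg : f ≤ g) :
    heatBath h f ≤ heatBath h g := by
  intro ω
  simp only [heatBath_apply, edgeUpdate_apply]
  gcongr with e
  · exact hh.nonneg ω e
  · exact hfg _
  · linarith [hh.le_one ω e]
  · exact hfg _

theorem heatBath_pow_mono (hh : IsMonotoneRate h) (t : ℕ) {f g : Finset E → ℝ} (hfg : f ≤ g) :
    (heatBath h ^ t) f ≤ (heatBath h ^ t) g := by
  induction t generalizing f g with
  | zero => simpa using hfg
  | succ t ih =>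
    simp only [pow_succ, Module.End.mul_apply]
    exact ih (heatBath_mono hh hfg)

/-- One step of the monotone coupling, tested against a pair of observables. -/
theorem heatBath_le_of_subset (hh : IsMonotoneRate h) {A B : Finset E → ℝ}
    (hAB : ∀ ω₁ ω₂, ω₂ ⊆ ω₁ → A ω₁ ≤ B ω₂) {ω₁ ω₂ : Finset E} (hω : ω₂ ⊆ ω₁) :
    heatBath h A ω₁ ≤ heatBath h B ω₂ := by
  simp only [heatBath_apply, edgeUpdate_apply]
  refine mul_le_mul_of_nonneg_left (Finset.sum_le_sum fun e _ => ?_) (by positivity)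
  -- Sharing one uniform variable leaves three outcomes: both open, only the larger open, both
  -- closed, with weights `h ω₂ e`, `h ω₁ e - h ω₂ e` and `1 - h ω₁ e`.
  have h1 := hAB (insert e ω₁) (insert e ω₂) (Finset.insert_subset_insert e hω)
  have h2 := hAB (insert e ω₁) (ω₂.erase e)
    ((Finset.erase_subset e ω₂).trans (hω.trans (Finset.subset_insert e ω₁)))
  have h3 := hAB (ω₁.erase e) (ω₂.erase e) (Finset.erase_subset_erase e hω)
  have h4 : h ω₂ e ≤ h ω₁ e := hh.mono e hω
  nlinarith [mul_le_mul_of_nonneg_left h1 (hh.nonneg ω₂ e),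
    mul_le_mul_of_nonneg_left h2 (sub_nonneg.2 h4),
    mul_le_mul_of_nonneg_left h3 (sub_nonneg.2 (hh.le_one ω₁ e))]

theorem heatBath_pow_le_of_subset (hh : IsMonotoneRate h) (t : ℕ) {A B : Finset E → ℝ}
    (hAB : ∀ ω₁ ω₂, ω₂ ⊆ ω₁ → A ω₁ ≤ B ω₂) {ω₁ ω₂ : Finset E} (hω : ω₂ ⊆ ω₁) :
    (heatBath h ^ t) A ω₁ ≤ (heatBath h ^ t) B ω₂ := by
  induction t generalizing A B with
  | zero => simpa using hAB _ _ hω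
  | succ t ih =>
    simp only [pow_succ, Module.End.mul_apply]
    exact ih fun _ _ h' => heatBath_le_of_subset hh hAB h'

theorem monotone_heatBath (hh : IsMonotoneRate h) {f : Finset E → ℝ} (hf : Monotone f) :
    Monotone (heatBath h f) := by
  intro ω ω' hω
  have := heatBath_le_of_subset hh (A := -f) (B := -f)
    (fun _ _ h' => by simpa using hf h') hω
  simpa using this

theorem monotone_heatBath_pow (hh : IsMonotoneRate h) {f : Finset E → ℝ} (hf : Monotone f)
    (t : ℕ) : Monotone ((heatBath h ^ t) f) := by
  induction t with
  | zero => simpa using hf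
  | succ t ih => rw [pow_succ']; exact monotone_heatBath hh ih

theorem monotone_lazyHeatBath_pow (hh : IsMonotoneRate h) {κ : ℝ} (h0 : 0 ≤ κ) (h1 : κ ≤ 1)
    {f : Finset E → ℝ} (hf : Monotone f) (t : ℕ) : Monotone ((lazyHeatBath κ h ^ t) f) := by
  induction t with
  | zero => simpa using hf
  | succ t ih =>
    rw [pow_succ']
    intro ω ω' hω
    simp only [Module.End.mul_apply, lazyHeatBath_apply]
    exact add_le_add (mul_le_mul_of_nonneg_left (ih hω) (by linarith))
      (mul_le_mul_of_nonneg_left (monotone_heatBath hh ih hω) h0)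

theorem heatBath_const [Nonempty E] (c : ℝ) : heatBath h (fun _ => c) = fun _ => c := by
  ext ω
  have : (Fintype.card E : ℝ) ≠ 0 := by exact_mod_cast Fintype.card_ne_zero
  simp only [heatBath_apply, edgeUpdate_apply]
  rw [Finset.sum_congr rfl (g := fun _ => c) (fun e _ => by ring)]
  simp [this]

theorem heatBath_pow_const [Nonempty E] (c : ℝ) (t : ℕ) :
    (heatBath h ^ t) (fun _ => c) = fun _ => c := by
  induction t with
  | zero => rfl
  | succ t ih => rw [pow_succ', Module.End.mul_apply, ih, heatBath_const]

theorem IsStationary.dotProduct_heatBath_pow (hμ : IsStationary h μ) (t : ℕ)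
    (f : Finset E → ℝ) : μ ⬝ᵥ (heatBath h ^ t) f = μ ⬝ᵥ f := by
  induction t with
  | zero => rfl
  | succ t ih => rw [pow_succ', Module.End.mul_apply, hμ.dotProduct_heatBath, ih]

theorem IsStationary.dotProduct_mono (hμ : IsStationary h μ) {f g : Finset E → ℝ}
    (hfg : f ≤ g) : μ ⬝ᵥ f ≤ μ ⬝ᵥ g :=
  Finset.sum_le_sum fun ω _ => mul_le_mul_of_nonneg_left (hfg ω) (hμ.nonneg ω)

theorem IsStationary.dotProduct_const (hμ : IsStationary h μ) (c : ℝ) :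
    (μ ⬝ᵥ fun _ => c) = c := by
  simp [dotProduct, ← Finset.sum_mul, hμ.sum_eq_one]

/-! Convergence to equilibrium. -/

/-- With at least the stated probability, the next updates pick the edges of `s` in one prescribed
order and close each of them. -/
theorem heatBath_pow_ge_sdiff (hh : IsMonotoneRate h) {c : ℝ} (hc0 : 0 ≤ c)
    (hc : ∀ ω e, c ≤ 1 - h ω e) {f : Finset E → ℝ} (hf : 0 ≤ f) (s : Finset E) (ω : Finset E) :
    (c / Fintype.card E) ^ s.card * f (ω \ s) ≤ (heatBath h ^ s.card) f ω := by
  induction s using Finset.induction generalizing ω with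
  | empty => simp
  | insert e s he ih =>
    rw [Finset.card_insert_of_notMem he, pow_succ', pow_succ', Module.End.mul_apply,
      heatBath_apply]
    set g := (heatBath h ^ s.card) f
    have hg : 0 ≤ g := by
      simpa using heatBath_pow_mono hh s.card hf
    have h1 : edgeUpdate h e g ω ≤ ∑ e, edgeUpdate h e g ω :=
      Finset.single_le_sum (f := fun e => edgeUpdate h e g ω) (fun e _ => by
        have := hh.nonneg ω e; have := hh.le_one ω e
        have := hg (insert e ω); have := hg (ω.erase e)
        simp only [edgeUpdate_apply, Pi.zero_apply] at *
        exact add_nonneg (by positivity) (mul_nonneg (by linarith) (by assumption)))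
        (Finset.mem_univ e)
    have h2 : c * g (ω.erase e) ≤ edgeUpdate h e g ω := by
      rw [edgeUpdate_apply]
      have := mul_nonneg (hh.nonneg ω e) (hg (insert e ω))
      have := mul_le_mul_of_nonneg_right (hc ω e) (hg (ω.erase e))
      linarith
    have h3 := ih (ω.erase e)
    have h4 : ω.erase e \ s = ω \ insert e s := by
      ext x; simp only [Finset.mem_sdiff, Finset.mem_erase, Finset.mem_insert]; tauto
    rw [h4] at h3
    calc c / Fintype.card E * (c / Fintype.card E) ^ s.card * f (ω \ insert e s)
        = 1 / Fintype.card E * (c * ((c / Fintype.card E) ^ s.card * f (ω \ insert e s))) := by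
          ring
      _ ≤ 1 / Fintype.card E * (c * g (ω.erase e)) := by gcongr
      _ ≤ _ := by gcongr; exact h2.trans h1

theorem heatBath_pow_ge_union (hh : IsMonotoneRate h) {c : ℝ} (hc0 : 0 ≤ c)
    (hc : ∀ ω e, c ≤ h ω e) {f : Finset E → ℝ} (hf : 0 ≤ f) (s : Finset E) (ω : Finset E) :
    (c / Fintype.card E) ^ s.card * f (ω ∪ s) ≤ (heatBath h ^ s.card) f ω := by
  induction s using Finset.induction generalizing ω with
  | empty => simp
  | insert e s he ih =>
    rw [Finset.card_insert_of_notMem he, pow_succ', pow_succ', Module.End.mul_apply,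
      heatBath_apply]
    set g := (heatBath h ^ s.card) f
    have hg : 0 ≤ g := by
      simpa using heatBath_pow_mono hh s.card hf
    have h1 : edgeUpdate h e g ω ≤ ∑ e, edgeUpdate h e g ω :=
      Finset.single_le_sum (f := fun e => edgeUpdate h e g ω) (fun e _ => by
        have := hh.nonneg ω e; have := hh.le_one ω e
        have := hg (insert e ω); have := hg (ω.erase e)
        simp only [edgeUpdate_apply, Pi.zero_apply] at *
        exact add_nonneg (by positivity) (mul_nonneg (by linarith) (by assumption)))
        (Finset.mem_univ e)
    have h2 : c * g (insert e ω) ≤ edgeUpdate h e g ω := by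
      rw [edgeUpdate_apply]
      have := mul_nonneg (sub_nonneg.2 (hh.le_one ω e)) (hg (ω.erase e))
      have := mul_le_mul_of_nonneg_right (hc ω e) (hg (insert e ω))
      linarith
    have h3 := ih (insert e ω)
    rw [Finset.insert_union, ← Finset.union_insert] at h3
    calc c / Fintype.card E * (c / Fintype.card E) ^ s.card * f (ω ∪ insert e s)
        = 1 / Fintype.card E * (c * ((c / Fintype.card E) ^ s.card * f (ω ∪ insert e s))) := by
          ring
      _ ≤ 1 / Fintype.card E * (c * g (insert e ω)) := by gcongr
      _ ≤ _ := by gcongr; exact h2.trans h1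

/-- All closing probabilities, or all opening probabilities, are bounded below. -/
def IsElliptic (h : Finset E → E → ℝ) : Prop :=
  ∃ c : ℝ, 0 < c ∧ ((∀ ω e, c ≤ 1 - h ω e) ∨ ∀ ω e, c ≤ h ω e)

/-- Doeblin's condition: closing every edge in turn, or opening every edge in turn, leads from any
start to the same configuration. -/
theorem exists_minorization [Nonempty E] (hh : IsMonotoneRate h) (hc : IsElliptic h) :
    ∃ δ : ℝ, 0 < δ ∧ ∃ m : ℕ, ∃ ω₀ : Finset E, ∀ f : Finset E → ℝ, 0 ≤ f → ∀ ω,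
      δ * f ω₀ ≤ (heatBath h ^ m) f ω := by
  obtain ⟨c, hc, h1 | h1⟩ := hc
  · refine ⟨(c / Fintype.card E) ^ (Finset.univ : Finset E).card, by
      have : 0 < (Fintype.card E : ℝ) := by exact_mod_cast Fintype.card_pos
      positivity, (Finset.univ : Finset E).card, ∅, fun f hf ω => ?_⟩
    have h2 : ω \ Finset.univ = ∅ := by ext; simp
    simpa only [h2] using heatBath_pow_ge_sdiff hh hc.le h1 hf Finset.univ ω
  · refine ⟨(c / Fintype.card E) ^ (Finset.univ : Finset E).card, by
      have : 0 < (Fintype.card E : ℝ) := by exact_mod_cast Fintype.card_pos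
      positivity, (Finset.univ : Finset E).card, Finset.univ, fun f hf ω => ?_⟩
    have h2 : ω ∪ Finset.univ = Finset.univ := by ext; simp
    simpa only [h2] using heatBath_pow_ge_union hh hc.le h1 hf Finset.univ ω

theorem heatBath_pow_mem_Icc [Nonempty E] (hh : IsMonotoneRate h) {f : Finset E → ℝ} {a b : ℝ}
    (hf : ∀ ω, f ω ∈ Set.Icc a b) (t : ℕ) (ω : Finset E) :
    (heatBath h ^ t) f ω ∈ Set.Icc a b := by
  have h1 := heatBath_pow_mono hh t (f := fun _ => a) (g := f) (fun ω => (hf ω).1) ω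
  have h2 := heatBath_pow_mono hh t (f := f) (g := fun _ => b) (fun ω => (hf ω).2) ω
  rw [heatBath_pow_const] at h1 h2
  exact ⟨h1, h2⟩

theorem exists_oscillation_le [Nonempty E] (hh : IsMonotoneRate h) (hc : IsElliptic h)
    (f : Finset E → ℝ) {ε : ℝ} (hε : 0 < ε) :
    ∃ (j : ℕ) (a b : ℝ), b - a ≤ ε ∧ ∀ ω, (heatBath h ^ j) f ω ∈ Set.Icc a b := by
  obtain ⟨δ, hδ, m, ω₀, hm⟩ := exists_minorization hh hc
  have hδ1 : δ ≤ 1 := by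
    have := hm (fun _ => 1) (fun _ => zero_le_one) ∅
    rw [heatBath_pow_const] at this
    simpa using this
  have key : ∀ i : ℕ, ∃ a b : ℝ, b - a = (1 - δ) ^ i * (∑ ω, |f ω| + ∑ ω, |f ω|) ∧
      ∀ ω, (heatBath h ^ (m * i)) f ω ∈ Set.Icc a b := by
    intro i
    induction i with
    | zero =>
      refine ⟨-∑ ω, |f ω|, ∑ ω, |f ω|, by simp, fun ω => ?_⟩
      have : |f ω| ≤ ∑ ω, |f ω| :=
        Finset.single_le_sum (f := fun ω => |f ω|) (fun _ _ => abs_nonneg _) (Finset.mem_univ ω)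
      simpa using abs_le.1 this
    | succ i ih =>
      obtain ⟨a, b, hab, hf⟩ := ih
      set g := (heatBath h ^ (m * i)) f with hg
      -- A block of `m` steps puts mass at least `δ` on `ω₀`, so both ends of the interval move
      -- towards `g ω₀` by the fraction `δ`.
      refine ⟨a + δ * (g ω₀ - a), b - δ * (b - g ω₀), ?_, fun ω => ?_⟩
      · rw [pow_succ]; linear_combination (1 - δ) * hab
      · rw [mul_add, mul_one, add_comm (m * i), pow_add, Module.End.mul_apply, ← hg]
        have h1 := hm (g - fun _ => a) (fun ω => sub_nonneg.2 (hf ω).1) ω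
        have h2 := hm ((fun _ => b) - g) (fun ω => sub_nonneg.2 (hf ω).2) ω
        rw [map_sub, heatBath_pow_const] at h1 h2
        simp only [Pi.sub_apply] at h1 h2
        exact ⟨by linarith, by linarith⟩
  have hlim : Filter.Tendsto (fun i : ℕ => (1 - δ) ^ i * (∑ ω, |f ω| + ∑ ω, |f ω|))
      Filter.atTop (nhds 0) := by
    simpa using (tendsto_pow_atTop_nhds_zero_of_lt_one (sub_nonneg.2 hδ1)
      (by linarith)).mul_const (∑ ω, |f ω| + ∑ ω, |f ω|)
  obtain ⟨i, hi⟩ := (hlim.eventually_le_const hε).exists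
  obtain ⟨a, b, hab, hf⟩ := key i
  exact ⟨m * i, a, b, hab.trans_le hi, hf⟩

theorem exists_abs_heatBath_pow_sub_le [Nonempty E] (hh : IsMonotoneRate h) (hc : IsElliptic h)
    (hμ : IsStationary h μ) (f : Finset E → ℝ) {ε : ℝ} (hε : 0 < ε) :
    ∃ j₀ : ℕ, ∀ j, j₀ ≤ j → ∀ ω, |(heatBath h ^ j) f ω - μ ⬝ᵥ f| ≤ ε := by
  obtain ⟨j₀, a, b, hab, hf⟩ := exists_oscillation_le hh hc f hε
  refine ⟨j₀, fun j hj ω => ?_⟩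
  obtain ⟨i, rfl⟩ := Nat.exists_eq_add_of_le' hj
  have h1 := heatBath_pow_mem_Icc hh hf i ω
  rw [← Module.End.mul_apply, ← pow_add] at h1
  have h2 := hμ.dotProduct_mono (f := fun _ => a) (fun ω => (hf ω).1)
  have h3 := hμ.dotProduct_mono (g := fun _ => b) (fun ω => (hf ω).2)
  rw [hμ.dotProduct_const, hμ.dotProduct_heatBath_pow] at h2 h3
  rw [abs_le]
  exact ⟨by linarith [h1.1], by linarith [h1.2]⟩

/-- The slowed chain has made a binomial number `J` of true steps, and the mean of `2^{-J}` is `(1 -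
κ/2)^t`. The point is that `B` does not depend on `κ`: the speed of a box inside the torus depends
on `n`. -/
theorem exists_abs_lazyHeatBath_pow_sub_le [Nonempty E] (hh : IsMonotoneRate h)
    (hc : IsElliptic h) (hμ : IsStationary h μ) (f : Finset E → ℝ) {ε : ℝ} (hε : 0 < ε) :
    ∃ B : ℝ, 0 ≤ B ∧ ∀ κ : ℝ, 0 ≤ κ → κ ≤ 1 → ∀ (t : ℕ) (ω : Finset E),
      |(lazyHeatBath κ h ^ t) f ω - μ ⬝ᵥ f| ≤ ε + B * (1 - κ / 2) ^ t := by
  obtain ⟨j₀, hj₀⟩ := exists_abs_heatBath_pow_sub_le hh hc hμ f hε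
  set M : ℝ := ∑ ω, |f ω| + |μ ⬝ᵥ f| with hM
  have hM0 : 0 ≤ M := by positivity
  -- The rate `1/2` is arbitrary: past `j₀` the error is already `ε`, and before `j₀` the factor `2
  -- ^ j₀ * (1/2) ^ j` is at least `1`.
  have hbase : ∀ (j : ℕ) (ω : Finset E),
      |(heatBath h ^ j) f ω - μ ⬝ᵥ f| ≤ ε + M * 2 ^ j₀ * (1 / 2) ^ j := by
    intro j ω
    rcases le_total j₀ j with hj | hj
    · exact (hj₀ j hj ω).trans (le_add_of_nonneg_right (by positivity))
    · have h1 : |(heatBath h ^ j) f ω| ≤ ∑ ω, |f ω| := by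
        refine abs_le.2 (heatBath_pow_mem_Icc hh (fun ω => ?_) j ω)
        exact abs_le.1 (Finset.single_le_sum (f := fun ω => |f ω|) (fun _ _ => abs_nonneg _)
          (Finset.mem_univ ω))
      have h2 : (1 : ℝ) ≤ 2 ^ j₀ * (1 / 2) ^ j := by
        obtain ⟨i, rfl⟩ := Nat.exists_eq_add_of_le hj
        rw [pow_add, mul_right_comm, ← mul_pow]
        norm_num
        exact one_le_pow₀ (by norm_num)
      have h3 := abs_sub ((heatBath h ^ j) f ω) (μ ⬝ᵥ f)
      have h4 := mul_le_mul_of_nonneg_left h2 hM0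
      nlinarith
  refine ⟨M * 2 ^ j₀, by positivity, fun κ h0 h1 t => ?_⟩
  -- Keeping `j` free lets a slow step either leave `j` alone or raise it by one.
  have key : ∀ (t j : ℕ) (ω : Finset E),
      |(lazyHeatBath κ h ^ t) ((heatBath h ^ j) f) ω - μ ⬝ᵥ f| ≤
        ε + M * 2 ^ j₀ * (1 / 2) ^ j * (1 - κ / 2) ^ t := by
    intro t
    induction t with
    | zero => intro j ω; simpa using hbase j ω
    | succ t ih =>
      intro j ω
      have heq : (lazyHeatBath κ h ^ (t + 1)) ((heatBath h ^ j) f) ω =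
          (1 - κ) * (lazyHeatBath κ h ^ t) ((heatBath h ^ j) f) ω +
            κ * (lazyHeatBath κ h ^ t) ((heatBath h ^ (j + 1)) f) ω := by
        rw [pow_succ (lazyHeatBath κ h), Module.End.mul_apply, pow_succ' (heatBath h),
          Module.End.mul_apply]
        have : lazyHeatBath κ h ((heatBath h ^ j) f) =
            (1 - κ) • (heatBath h ^ j) f + κ • heatBath h ((heatBath h ^ j) f) := by
          simp [lazyHeatBath]
        simp [this]
      have h2 := abs_le.1 (ih j ω)
      have h3 := abs_le.1 (ih (j + 1) ω)
      have h4 : ε + M * 2 ^ j₀ * (1 / 2) ^ j * (1 - κ / 2) ^ (t + 1) =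
          (1 - κ) * (ε + M * 2 ^ j₀ * (1 / 2) ^ j * (1 - κ / 2) ^ t) +
            κ * (ε + M * 2 ^ j₀ * (1 / 2) ^ (j + 1) * (1 - κ / 2) ^ t) := by
        rw [pow_succ, pow_succ]; ring
      rw [heq, h4, abs_le]
      have hκ : 0 ≤ 1 - κ := by linarith
      have := mul_le_mul_of_nonneg_left h2.1 hκ
      have := mul_le_mul_of_nonneg_left h2.2 hκ
      have := mul_le_mul_of_nonneg_left h3.1 h0
      have := mul_le_mul_of_nonneg_left h3.2 h0
      exact ⟨by linarith, by linarith⟩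
  intro ω
  simpa using key t 0 ω

end HeatBath

/-! ### Comparison of the dynamics on a graph with the dynamics on a subgraph. -/

section Restriction

variable {E E' : Type*} [DecidableEq E] [DecidableEq E'] [Fintype E']

/-- The configuration that `ω` induces on the edges of a subgraph. -/
def restrictConfig (ι : E' ↪ E) (ω : Finset E) : Finset E' :=
  Finset.univ.filter fun e => ι e ∈ ω

variable (ι : E' ↪ E)

theorem mem_restrictConfig {ω : Finset E} {e : E'} : e ∈ restrictConfig ι ω ↔ ι e ∈ ω := by
  simp [restrictConfig]

theorem restrictConfig_mono : Monotone (restrictConfig ι) := fun _ _ hω _ he =>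
  (mem_restrictConfig ι).2 (hω ((mem_restrictConfig ι).1 he))

theorem restrictConfig_insert (e : E') (ω : Finset E) :
    restrictConfig ι (insert (ι e) ω) = insert e (restrictConfig ι ω) := by
  ext x; simp [mem_restrictConfig]

theorem restrictConfig_erase (e : E') (ω : Finset E) :
    restrictConfig ι (ω.erase (ι e)) = (restrictConfig ι ω).erase e := by
  ext x; simp [mem_restrictConfig]

theorem restrictConfig_insert_of_notMem {e : E} (he : e ∉ Set.range ι) (ω : Finset E) :
    restrictConfig ι (insert e ω) = restrictConfig ι ω := by
  ext x
  have : ι x ≠ e := fun h => he ⟨x, h⟩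
  simp [mem_restrictConfig, this]

theorem restrictConfig_erase_of_notMem {e : E} (he : e ∉ Set.range ι) (ω : Finset E) :
    restrictConfig ι (ω.erase e) = restrictConfig ι ω := by
  ext x
  have : ι x ≠ e := fun h => he ⟨x, h⟩
  simp [mem_restrictConfig, this]

theorem openInd_comp_restrictConfig (e : E') :
    openInd e ∘ restrictConfig ι = openInd (ι e) := by
  ext ω; simp [openInd, mem_restrictConfig]

theorem openInd_eq_of_restrictConfig_eq {ω₁ ω₂ : Finset E}
    (hω : restrictConfig ι ω₁ = restrictConfig ι ω₂) (e : E') :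
    openInd (ι e) ω₁ = openInd (ι e) ω₂ := by
  rw [← openInd_comp_restrictConfig, Function.comp, Function.comp, hω]

variable [Fintype E] {h : Finset E → E → ℝ} {k : Finset E' → E' → ℝ}

/-- The relative speed at which the edges of a subgraph are updated. -/
def updateSpeed (E' E : Type*) [Fintype E'] [Fintype E] : ℝ := Fintype.card E' / Fintype.card E

include ι in
theorem updateSpeed_le_one : updateSpeed E' E ≤ 1 :=
  div_le_one_of_le₀ (by exact_mod_cast Fintype.card_le_of_embedding ι) (by positivity)

theorem updateSpeed_nonneg : 0 ≤ updateSpeed E' E := by unfold updateSpeed; positivity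

/-- Updates outside the subgraph do not change the restriction. Written as an increment, the step
has the same shape as in `lazyHeatBath_updateSpeed`, so the two chains can be compared edge by edge.
-/
theorem heatBath_comp_restrictConfig [Nonempty E] (f : Finset E' → ℝ) (ω : Finset E) :
    heatBath h (f ∘ restrictConfig ι) ω = f (restrictConfig ι ω) +
      1 / (Fintype.card E : ℝ) * ∑ e : E', (h ω (ι e) * f (insert e (restrictConfig ι ω)) +
        (1 - h ω (ι e)) * f ((restrictConfig ι ω).erase e) - f (restrictConfig ι ω)) := by
  have hE : (Fintype.card E : ℝ) ≠ 0 := by exact_mod_cast Fintype.card_ne_zero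
  have hsum := Fintype.sum_of_injective ι ι.injective
    (fun e : E' => h ω (ι e) * f (insert e (restrictConfig ι ω)) +
        (1 - h ω (ι e)) * f ((restrictConfig ι ω).erase e) - f (restrictConfig ι ω))
    (fun e : E => edgeUpdate h e (f ∘ restrictConfig ι) ω - f (restrictConfig ι ω))
    (fun e he => by
      simp only [edgeUpdate_apply, Function.comp, restrictConfig_insert_of_notMem ι he,
        restrictConfig_erase_of_notMem ι he]
      ring)
    (fun e => by
      simp only [edgeUpdate_apply, Function.comp, restrictConfig_insert, restrictConfig_erase])
  rw [hsum, heatBath_apply, Finset.sum_sub_distrib]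
  simp only [Finset.sum_const, Finset.card_univ, nsmul_eq_mul]
  field_simp
  ring

theorem lazyHeatBath_updateSpeed [Nonempty E] [Nonempty E'] (f : Finset E' → ℝ)
    (η : Finset E') :
    lazyHeatBath (updateSpeed E' E) k f η = f η +
      1 / (Fintype.card E : ℝ) * ∑ e : E', (edgeUpdate k e f η - f η) := by
  have hE : (Fintype.card E : ℝ) ≠ 0 := by exact_mod_cast Fintype.card_ne_zero
  have hE' : (Fintype.card E' : ℝ) ≠ 0 := by exact_mod_cast Fintype.card_ne_zero
  rw [lazyHeatBath_apply, heatBath_apply, Finset.sum_sub_distrib, updateSpeed]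
  simp only [Finset.sum_const, Finset.card_univ, nsmul_eq_mul]
  field_simp
  ring

variable [Nonempty E] [Nonempty E']

theorem heatBath_comp_restrictConfig_le (hle : ∀ ω e, h ω (ι e) ≤ k (restrictConfig ι ω) e)
    {f : Finset E' → ℝ} (hf : Monotone f) (ω : Finset E) :
    heatBath h (f ∘ restrictConfig ι) ω ≤
      lazyHeatBath (updateSpeed E' E) k f (restrictConfig ι ω) := by
  rw [heatBath_comp_restrictConfig, lazyHeatBath_updateSpeed]
  refine add_le_add le_rfl (mul_le_mul_of_nonneg_left (Finset.sum_le_sum fun e _ => ?_)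
    (by positivity))
  have h1 : f ((restrictConfig ι ω).erase e) ≤ f (insert e (restrictConfig ι ω)) :=
    hf ((Finset.erase_subset _ _).trans (Finset.subset_insert _ _))
  rw [edgeUpdate_apply]
  nlinarith [mul_le_mul_of_nonneg_right (hle ω e) (sub_nonneg.2 h1)]

theorem le_heatBath_comp_restrictConfig (hge : ∀ ω e, k (restrictConfig ι ω) e ≤ h ω (ι e))
    {f : Finset E' → ℝ} (hf : Monotone f) (ω : Finset E) :
    lazyHeatBath (updateSpeed E' E) k f (restrictConfig ι ω) ≤
      heatBath h (f ∘ restrictConfig ι) ω := by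
  rw [heatBath_comp_restrictConfig, lazyHeatBath_updateSpeed]
  refine add_le_add le_rfl (mul_le_mul_of_nonneg_left (Finset.sum_le_sum fun e _ => ?_)
    (by positivity))
  have h1 : f ((restrictConfig ι ω).erase e) ≤ f (insert e (restrictConfig ι ω)) :=
    hf ((Finset.erase_subset _ _).trans (Finset.subset_insert _ _))
  rw [edgeUpdate_apply]
  nlinarith [mul_le_mul_of_nonneg_right (hge ω e) (sub_nonneg.2 h1)]

/-- The one-step comparison needs an increasing observable. It iterates because the subgraph chain,
being monotone, keeps `f` increasing. -/
theorem heatBath_pow_comp_restrictConfig_le (hh : IsMonotoneRate h) (hk : IsMonotoneRate k)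
    (hle : ∀ ω e, h ω (ι e) ≤ k (restrictConfig ι ω) e)
    {f : Finset E' → ℝ} (hf : Monotone f) (s t : ℕ) (ω : Finset E) :
    (heatBath h ^ s) ((lazyHeatBath (updateSpeed E' E) k ^ t) f ∘ restrictConfig ι) ω ≤
      (lazyHeatBath (updateSpeed E' E) k ^ (t + s)) f (restrictConfig ι ω) := by
  induction s generalizing t ω with
  | zero => simp
  | succ s ih =>
    rw [pow_succ, Module.End.mul_apply, add_comm s 1, ← add_assoc]
    refine (heatBath_pow_mono hh s (fun ω => ?_) ω).trans (ih (t + 1) ω)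
    rw [Function.comp, pow_succ', Module.End.mul_apply]
    exact heatBath_comp_restrictConfig_le ι hle (monotone_lazyHeatBath_pow hk updateSpeed_nonneg
      (updateSpeed_le_one ι) hf t) ω

theorem le_heatBath_pow_comp_restrictConfig (hh : IsMonotoneRate h) (hk : IsMonotoneRate k)
    (hge : ∀ ω e, k (restrictConfig ι ω) e ≤ h ω (ι e))
    {f : Finset E' → ℝ} (hf : Monotone f) (s t : ℕ) (ω : Finset E) :
    (lazyHeatBath (updateSpeed E' E) k ^ (t + s)) f (restrictConfig ι ω) ≤
      (heatBath h ^ s) ((lazyHeatBath (updateSpeed E' E) k ^ t) f ∘ restrictConfig ι) ω := by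
  induction s generalizing t ω with
  | zero => simp
  | succ s ih =>
    rw [pow_succ, Module.End.mul_apply, add_comm s 1, ← add_assoc]
    refine (ih (t + 1) ω).trans (heatBath_pow_mono hh s (fun ω => ?_) ω)
    rw [Function.comp, pow_succ', Module.End.mul_apply]
    exact le_heatBath_comp_restrictConfig ι hge (monotone_lazyHeatBath_pow hk updateSpeed_nonneg
      (updateSpeed_le_one ι) hf t) ω

variable {μ : Finset E → ℝ} {ν : Finset E' → ℝ}

include ι in
theorem eventually_abs_lazyHeatBath_pow_sub_le (hk : IsMonotoneRate k) (hc : IsElliptic k)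
    (hν : IsStationary k ν) (f : Finset E' → ℝ) {ε : ℝ} (hε : 0 < ε) :
    ∀ᶠ t in Filter.atTop, ∀ η : Finset E',
      |(lazyHeatBath (updateSpeed E' E) k ^ t) f η - ν ⬝ᵥ f| ≤ ε := by
  obtain ⟨B, hB, hlim⟩ := exists_abs_lazyHeatBath_pow_sub_le hk hc hν f (half_pos hε)
  have hpos : 0 < updateSpeed E' E := by
    have : 0 < (Fintype.card E : ℝ) := by exact_mod_cast Fintype.card_pos
    have : 0 < (Fintype.card E' : ℝ) := by exact_mod_cast Fintype.card_pos
    unfold updateSpeed; positivity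
  have h1 := updateSpeed_le_one ι
  have htend : Filter.Tendsto (fun t : ℕ => B * (1 - updateSpeed E' E / 2) ^ t)
      Filter.atTop (nhds 0) := by
    simpa using (tendsto_pow_atTop_nhds_zero_of_lt_one (by linarith)
      (by linarith)).const_mul B
  filter_upwards [htend.eventually_le_const (half_pos hε)] with t ht η
  linarith [hlim _ hpos.le h1 t η]

/-- Running the large chain from `μ` for more steps changes nothing on the left, while the
dominating subgraph chain converges to `ν`. -/
theorem IsStationary.dotProduct_comp_restrictConfig_le (hh : IsMonotoneRate h)
    (hμ : IsStationary h μ) (hk : IsMonotoneRate k) (hc : IsElliptic k) (hν : IsStationary k ν)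
    (hle : ∀ ω e, h ω (ι e) ≤ k (restrictConfig ι ω) e)
    {f : Finset E' → ℝ} (hf : Monotone f) (t : ℕ) :
    μ ⬝ᵥ ((lazyHeatBath (updateSpeed E' E) k ^ t) f ∘ restrictConfig ι) ≤ ν ⬝ᵥ f := by
  refine le_of_forall_pos_le_add fun ε hε => ?_
  obtain ⟨s, hs, hst⟩ := ((eventually_abs_lazyHeatBath_pow_sub_le ι hk hc hν f hε).and
    (Filter.eventually_ge_atTop t)).exists
  obtain ⟨r, rfl⟩ := Nat.exists_eq_add_of_le hst
  rw [← hμ.dotProduct_heatBath_pow r, ← hμ.dotProduct_const (ν ⬝ᵥ f + ε)]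
  refine hμ.dotProduct_mono fun ω => ?_
  have := heatBath_pow_comp_restrictConfig_le ι hh hk hle hf r t ω
  linarith [(abs_le.1 (hs (restrictConfig ι ω))).2]

theorem IsStationary.le_dotProduct_comp_restrictConfig (hh : IsMonotoneRate h)
    (hμ : IsStationary h μ) (hk : IsMonotoneRate k) (hc : IsElliptic k) (hν : IsStationary k ν)
    (hge : ∀ ω e, k (restrictConfig ι ω) e ≤ h ω (ι e))
    {f : Finset E' → ℝ} (hf : Monotone f) (t : ℕ) :
    ν ⬝ᵥ f ≤ μ ⬝ᵥ ((lazyHeatBath (updateSpeed E' E) k ^ t) f ∘ restrictConfig ι) := by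
  refine le_of_forall_pos_sub_le fun ε hε => ?_
  obtain ⟨s, hs, hst⟩ := ((eventually_abs_lazyHeatBath_pow_sub_le ι hk hc hν f hε).and
    (Filter.eventually_ge_atTop t)).exists
  obtain ⟨r, rfl⟩ := Nat.exists_eq_add_of_le hst
  rw [← hμ.dotProduct_heatBath_pow r, ← hμ.dotProduct_const (ν ⬝ᵥ f - ε)]
  refine hμ.dotProduct_mono fun ω => ?_
  have := le_heatBath_pow_comp_restrictConfig ι hh hk hge hf r t ω
  linarith [(abs_le.1 (hs (restrictConfig ι ω))).1]

end Restriction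

/-! The probability of disagreement at an edge, under the monotone coupling of the chains started
from the full and from the empty configuration. -/

section Disagreement

variable {E : Type*} [DecidableEq E] [Fintype E]

/-- The difference of the probabilities that `e` is open at time `t`, for the chains started from
the full and from the empty configuration. -/
def disagreement (h : Finset E → E → ℝ) (t : ℕ) (e : E) : ℝ :=
  (heatBath h ^ t) (openInd e) Finset.univ - (heatBath h ^ t) (openInd e) ∅

variable {h : Finset E → E → ℝ} {μ : Finset E → ℝ}

theorem disagreement_nonneg (hh : IsMonotoneRate h) (t : ℕ) (e : E) : 0 ≤ disagreement h t e :=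
  sub_nonneg.2 (monotone_heatBath_pow hh (openInd_mono e) t (Finset.empty_subset _))

theorem one_le_sum_openInd_sub {α : Type*} [Fintype α] (ι : α → E) {ω₁ ω₂ : Finset E}
    (hω : ω₂ ⊆ ω₁) {a : α} (h1 : ι a ∈ ω₁) (h2 : ι a ∉ ω₂) :
    1 ≤ ∑ a, openInd (ι a) ω₁ - ∑ a, openInd (ι a) ω₂ := by
  rw [← Finset.sum_sub_distrib]
  refine le_trans ?_ (Finset.single_le_sum (f := fun a => openInd (ι a) ω₁ - openInd (ι a) ω₂)
    (fun a _ => sub_nonneg.2 (openInd_mono (ι a) hω)) (Finset.mem_univ a))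
  simp [openInd, h1, h2]

theorem heatBath_pow_sum_openInd {α : Type*} [Fintype α] (ι : α → E) (t : ℕ) (ω : Finset E) :
    (heatBath h ^ t) (fun ω => ∑ a, openInd (ι a) ω) ω =
      ∑ a, (heatBath h ^ t) (openInd (ι a)) ω := by
  have : (fun ω => ∑ a, openInd (ι a) ω) = ∑ a, openInd (ι a) := by
    ext ω; simp
  rw [this, map_sum, Finset.sum_apply]

/-- Convergence of the chain to equilibrium is controlled by the disagreement probabilities. -/
theorem heatBath_pow_sub_dotProduct_le (hh : IsMonotoneRate h)
    (hμ : IsStationary h μ) {f : Finset E → ℝ} (hf : ∀ ω, f ω ∈ Set.Icc (0 : ℝ) 1) (t : ℕ)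
    (ω : Finset E) :
    (heatBath h ^ t) f ω - μ ⬝ᵥ f ≤ 2 * ∑ e, disagreement h t e := by
  set S : Finset E → ℝ := fun ω => ∑ e, openInd e ω with hS
  -- A strict inclusion raises the number `S` of open edges by at least one, which outweighs any
  -- decrease of `g`. Arbitrary events thus become accessible to monotonicity.
  have hmono : ∀ g : Finset E → ℝ, (∀ ω ω', g ω - g ω' ≤ 1) → Monotone (g + S) := by
    intro g hg ω ω' hω
    rcases hω.eq_or_lt with rfl | hlt
    · exact le_rfl
    · obtain ⟨e, he, he'⟩ := Finset.exists_of_ssubset hlt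
      have := one_le_sum_openInd_sub (fun e : E => e) hω he he'
      simp only [Pi.add_apply, hS]
      linarith [hg ω ω']
  have hSt : ∀ ω, (heatBath h ^ t) S ω = ∑ e, (heatBath h ^ t) (openInd e) ω :=
    heatBath_pow_sum_openInd (fun e : E => e) t
  have hD : ∀ ω, (heatBath h ^ t) S Finset.univ - (heatBath h ^ t) S ω ≤
      ∑ e, disagreement h t e := by
    intro ω
    rw [hSt, hSt, ← Finset.sum_sub_distrib]
    refine Finset.sum_le_sum fun e _ => sub_le_sub_left ?_ _
    exact monotone_heatBath_pow hh (openInd_mono e) t (Finset.empty_subset _)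
  have h1 := monotone_heatBath_pow hh (hmono f fun x y => by linarith [(hf x).2, (hf y).1]) t
    (Finset.subset_univ ω)
  -- The start `ω` is compared with the full start through `f + S`, and the full start with
  -- equilibrium through `-f + S`; each comparison costs one sum of disagreements.
  have h2 : μ ⬝ᵥ (heatBath h ^ t) (-f + S) ≤
      μ ⬝ᵥ fun _ => (heatBath h ^ t) (-f + S) Finset.univ :=
    hμ.dotProduct_mono fun ω => monotone_heatBath_pow hh
      (hmono (-f) fun x y => by simp only [Pi.neg_apply]; linarith [(hf y).2, (hf x).1]) t
      (Finset.subset_univ ω)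
  have h3 : (μ ⬝ᵥ fun _ => (heatBath h ^ t) S Finset.univ - ∑ e, disagreement h t e) ≤
      μ ⬝ᵥ (heatBath h ^ t) S :=
    hμ.dotProduct_mono fun ω => by have := hD ω; simp only; linarith
  rw [hμ.dotProduct_const] at h2 h3
  rw [hμ.dotProduct_heatBath_pow] at h2 h3
  simp only [map_add, map_neg, Pi.add_apply, Pi.neg_apply, dotProduct_add, dotProduct_neg]
    at h1 h2
  linarith [hD ω]

variable {E' : Type*} [DecidableEq E'] [Fintype E'] [Nonempty E] [Nonempty E'] (ι : E' ↪ E)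
  {kw kf : Finset E' → E' → ℝ} {νw νf : Finset E' → ℝ}

theorem disagreement_le_lazyHeatBath (hh : IsMonotoneRate h) (hkw : IsMonotoneRate kw)
    (hkf : IsMonotoneRate kf) (hle : ∀ ω e, h ω (ι e) ≤ kw (restrictConfig ι ω) e)
    (hge : ∀ ω e, kf (restrictConfig ι ω) e ≤ h ω (ι e)) (t : ℕ) (e : E') :
    disagreement h t (ι e) ≤
      (lazyHeatBath (updateSpeed E' E) kw ^ t) (openInd e) (restrictConfig ι Finset.univ) -
      (lazyHeatBath (updateSpeed E' E) kf ^ t) (openInd e) (restrictConfig ι ∅) := by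
  have h1 := heatBath_pow_comp_restrictConfig_le ι hh hkw hle (openInd_mono e) t 0 Finset.univ
  have h2 := le_heatBath_pow_comp_restrictConfig ι hh hkf hge (openInd_mono e) t 0 ∅
  simp only [pow_zero, Module.End.one_apply, openInd_comp_restrictConfig, zero_add] at h1 h2
  exact sub_le_sub h1 h2

/-- The disagreement probabilities are submultiplicative, up to the number of edges of a box and
the influence of the boundary of the box. -/
theorem disagreement_add_le (hh : IsMonotoneRate h) (hμ : IsStationary h μ)
    (hkw : IsMonotoneRate kw) (hkf : IsMonotoneRate kf) (hcw : IsElliptic kw)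
    (hcf : IsElliptic kf) (hνw : IsStationary kw νw) (hνf : IsStationary kf νf)
    (hle : ∀ ω e, h ω (ι e) ≤ kw (restrictConfig ι ω) e)
    (hge : ∀ ω e, kf (restrictConfig ι ω) e ≤ h ω (ι e)) {s t : ℕ} {a b : ℝ}
    (ha : ∀ e, disagreement h s e ≤ a) (hb : ∀ e, disagreement h t e ≤ b) (e₀ : E') :
    disagreement h (s + t) (ι e₀) ≤ Fintype.card E' * a * b +
      2 * (νw ⬝ᵥ openInd e₀ - νf ⬝ᵥ openInd e₀) := by
  have hb0 : 0 ≤ b := (disagreement_nonneg hh t (ι e₀)).trans (hb _)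
  set g := (heatBath h ^ t) (openInd (ι e₀)) with hg
  set W := (lazyHeatBath (updateSpeed E' E) kw ^ t) (openInd e₀)
  set F := (lazyHeatBath (updateSpeed E' E) kf ^ t) (openInd e₀)
  set S : Finset E → ℝ := fun ω => ∑ e, openInd (ι e) ω with hS
  have hgW : ∀ ω, g ω ≤ W (restrictConfig ι ω) := fun ω => by
    have := heatBath_pow_comp_restrictConfig_le ι hh hkw hle (openInd_mono e₀) t 0 ω
    simpa only [pow_zero, Module.End.one_apply, openInd_comp_restrictConfig, zero_add] using this
  have hFg : ∀ ω, F (restrictConfig ι ω) ≤ g ω := fun ω => by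
    have := le_heatBath_pow_comp_restrictConfig ι hh hkf hge (openInd_mono e₀) t 0 ω
    simpa only [pow_zero, Module.End.one_apply, openInd_comp_restrictConfig, zero_add] using this
  have hmono : Monotone g := monotone_heatBath_pow hh (openInd_mono _) t
  -- If the pair agrees in the box, the change of `g` is at most the gap between `W` and `F` at the
  -- common restriction. Otherwise it is at most `b`, which is paid for by a disagreeing edge in
  -- `S`. The gap is evaluated at either member of the pair, so that it can be placed on the
  -- stationary one.
  have key : ∀ ω₁ ω₂, ω₂ ⊆ ω₁ →
      g ω₁ - b * S ω₁ ≤ g ω₂ - b * S ω₂ + (W (restrictConfig ι ω₂) - F (restrictConfig ι ω₂)) ∧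
      g ω₁ - b * S ω₁ - (W (restrictConfig ι ω₁) - F (restrictConfig ι ω₁)) ≤
        g ω₂ - b * S ω₂ := by
    intro ω₁ ω₂ hω
    by_cases heq : restrictConfig ι ω₁ = restrictConfig ι ω₂
    · have hSeq : S ω₁ = S ω₂ :=
        Finset.sum_congr rfl fun e _ => openInd_eq_of_restrictConfig_eq ι heq e
      have h1 := hgW ω₁
      have h2 := hFg ω₂
      rw [hSeq, heq] at *
      constructor <;> linarith
    · obtain ⟨e, he1, he2⟩ : ∃ e, ι e ∈ ω₁ ∧ ι e ∉ ω₂ := by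
        by_contra! hcon
        exact heq (Finset.Subset.antisymm
          (fun e he => (mem_restrictConfig ι).2 (hcon e ((mem_restrictConfig ι).1 he)))
          (restrictConfig_mono ι hω))
      have h1 : 1 ≤ S ω₁ - S ω₂ := one_le_sum_openInd_sub ι hω he1 he2
      have h2 : g ω₁ - g ω₂ ≤ b := by
        have := hmono (Finset.subset_univ ω₁)
        have := hmono (Finset.empty_subset ω₂)
        have : g Finset.univ - g ∅ ≤ b := hb (ι e₀)
        linarith
      have h3 := mul_le_mul_of_nonneg_left h1 hb0
      constructor <;> linarith [hgW ω₁, hFg ω₁, hgW ω₂, hFg ω₂]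
  set R : Finset E → ℝ := W ∘ restrictConfig ι - F ∘ restrictConfig ι with hR
  -- The law of `W - F` is accessible only in equilibrium, so the stationary chain is inserted
  -- between the full and the empty start. The two comparisons produce the factor `2`.
  have h1 : (μ ⬝ᵥ fun _ => (heatBath h ^ s) (g - b • S) Finset.univ) ≤
      μ ⬝ᵥ (heatBath h ^ s) (g - b • S + R) :=
    hμ.dotProduct_mono fun ω => heatBath_pow_le_of_subset hh s
      (fun ω₁ ω₂ hω => by simpa [hR] using (key ω₁ ω₂ hω).1) (Finset.subset_univ ω)
  have h2 : μ ⬝ᵥ (heatBath h ^ s) (g - b • S - R) ≤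
      μ ⬝ᵥ fun _ => (heatBath h ^ s) (g - b • S) ∅ :=
    hμ.dotProduct_mono fun ω => heatBath_pow_le_of_subset hh s
      (fun ω₁ ω₂ hω => by simpa [hR] using (key ω₁ ω₂ hω).2) (Finset.empty_subset ω)
  have h3 : μ ⬝ᵥ R ≤ νw ⬝ᵥ openInd e₀ - νf ⬝ᵥ openInd e₀ := by
    rw [hR, dotProduct_sub]
    exact sub_le_sub
      (hμ.dotProduct_comp_restrictConfig_le ι hh hkw hcw hνw hle (openInd_mono e₀) t)
      (hμ.le_dotProduct_comp_restrictConfig ι hh hkf hcf hνf hge (openInd_mono e₀) t)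
  rw [hμ.dotProduct_const, hμ.dotProduct_heatBath_pow, dotProduct_add] at h1
  rw [hμ.dotProduct_const, hμ.dotProduct_heatBath_pow, dotProduct_sub] at h2
  have h4 : (heatBath h ^ s) g = (heatBath h ^ (s + t)) (openInd (ι e₀)) := by
    rw [hg, pow_add, Module.End.mul_apply]
  simp only [map_sub, map_smul, Pi.sub_apply, Pi.smul_apply, smul_eq_mul, h4] at h1 h2
  have h5 : (heatBath h ^ s) S Finset.univ - (heatBath h ^ s) S ∅ ≤ Fintype.card E' * a := by
    rw [hS, heatBath_pow_sum_openInd, heatBath_pow_sum_openInd, ← Finset.sum_sub_distrib]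
    refine (Finset.sum_le_sum fun e _ => ha (ι e)).trans ?_
    simp
  have h6 := mul_le_mul_of_nonneg_left h5 hb0
  unfold disagreement
  linarith

end Disagreement

/-! ### Merging two classes of a partition. -/

section Gluing

variable {V : Type*}

/-- The partition obtained from `S` by merging the classes of `a` and `b`. -/
def mergeSetoid (S : Setoid V) (a b : V) : Setoid V where
  r x y := S x y ∨ (S x a ∧ S b y) ∨ (S x b ∧ S a y)
  iseqv :=
    { refl := fun x => Or.inl (S.refl x)
      symm := by
        rintro x y (h | ⟨h, h'⟩ | ⟨h, h'⟩)
        · exact Or.inl (S.symm h)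
        · exact Or.inr (Or.inr ⟨S.symm h', S.symm h⟩)
        · exact Or.inr (Or.inl ⟨S.symm h', S.symm h⟩)
      trans := by
        rintro x y z (h | ⟨h, h'⟩ | ⟨h, h'⟩) (k | ⟨k, k'⟩ | ⟨k, k'⟩)
        · exact Or.inl (S.trans h k)
        · exact Or.inr (Or.inl ⟨S.trans h k, k'⟩)
        · exact Or.inr (Or.inr ⟨S.trans h k, k'⟩)
        · exact Or.inr (Or.inl ⟨h, S.trans h' k⟩)
        · exact Or.inr (Or.inl ⟨h, k'⟩)
        · exact Or.inl (S.trans h k')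
        · exact Or.inr (Or.inr ⟨h, S.trans h' k⟩)
        · exact Or.inl (S.trans h k')
        · exact Or.inr (Or.inr ⟨h, k'⟩) }

theorem mergeSetoid_apply {S : Setoid V} {a b x y : V} :
    mergeSetoid S a b x y ↔ S x y ∨ (S x a ∧ S b y) ∨ (S x b ∧ S a y) := Iff.rfl

theorem mergeSetoid_eq_self {S : Setoid V} {a b : V} (h : S a b) : mergeSetoid S a b = S := by
  ext x y
  rw [mergeSetoid_apply]
  refine ⟨?_, Or.inl⟩
  rintro (k | ⟨k, k'⟩ | ⟨k, k'⟩)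
  · exact k
  · exact S.trans k (S.trans h k')
  · exact S.trans k (S.trans (S.symm h) k')

theorem card_quotient_mergeSetoid [Finite V] {S : Setoid V} {a b : V} (h : ¬ S a b) :
    Nat.card (Quotient S) = Nat.card (Quotient (mergeSetoid S a b)) + 1 := by
  classical
  have : Fintype V := Fintype.ofFinite V
  let T := mergeSetoid S a b
  -- The class of `b` is dropped, and the class of `a` represents the merged class.
  let g : {c : Quotient S // c ≠ Quotient.mk S b} → Quotient T := fun c =>
    Quotient.map' (s₁ := S) (s₂ := T) id (fun _ _ h => Or.inl h) c.1
  have hg : Function.Bijective g := by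
    constructor
    · rintro ⟨c, hc⟩ ⟨c', hc'⟩ hcc
      induction c using Quotient.inductionOn with | _ x
      induction c' using Quotient.inductionOn with | _ y
      have hx : ¬ S x b := fun h => hc (Quotient.sound h)
      have hy : ¬ S y b := fun h => hc' (Quotient.sound h)
      have hxy : T x y := Quotient.exact hcc
      apply Subtype.ext
      refine Quotient.sound (s := S) ?_
      rcases hxy with k | ⟨k, k'⟩ | ⟨k, k'⟩
      · exact k
      · exact absurd (S.symm k') hy
      · exact absurd k hx
    · intro c
      induction c using Quotient.inductionOn with | _ x
      by_cases hx : S x b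
      · refine ⟨⟨Quotient.mk S a, fun h' => h (Quotient.exact h')⟩, ?_⟩
        exact Quotient.sound (s := T) (Or.inr (Or.inl ⟨S.refl a, S.symm hx⟩))
      · exact ⟨⟨Quotient.mk S x, fun h' => hx (Quotient.exact h')⟩, rfl⟩
  rw [← Nat.card_congr (Equiv.ofBijective g hg), Nat.card_eq_fintype_card,
    Nat.card_eq_fintype_card, Fintype.card_subtype_compl, Fintype.card_subtype_eq]
  have : 0 < Fintype.card (Quotient S) := Fintype.card_pos_iff.2 ⟨Quotient.mk S b⟩
  omega

end Gluing

theorem exists_sym2_eq {V : Type*} (e : Sym2 V) : ∃ a b, e = s(a, b) :=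
  Sym2.inductionOn e fun a b => ⟨a, b, rfl⟩

theorem insert_erase_eq_insert {α : Type*} [DecidableEq α] (a : α) (s : Finset α) :
    insert a (s.erase a) = insert a s := by
  ext x; simp only [Finset.mem_insert, Finset.mem_erase]; tauto

/-! ### Connectivity, monotonicity and detailed balance for the random-cluster model. -/

section RandomCluster

variable {V : Type*} (G : SimpleGraph V) (ξ : Setoid V)

/-- The partition of the vertices into the connected components of `ω`, after the vertices in
each class of `ξ` are identified. -/
def compSetoid (ω : Config G) : Setoid V := (openGraph G ω).reachableSetoid ⊔ ξ

variable {G ξ}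

/-- The partition into components is the least one containing `ξ` and joining the ends of every open
edge. This universal property replaces arguments with paths. -/
theorem compSetoid_le_iff {ω : Config G} {S : Setoid V} :
    compSetoid G ξ ω ≤ S ↔
      (∀ e ∈ ω, ∀ x y, (e : Sym2 V) = s(x, y) → S x y) ∧ ξ ≤ S := by
  rw [compSetoid, sup_le_iff]
  refine and_congr_left fun _ => ⟨fun h e he x y hxy => ?_, fun h x y hxy => ?_⟩
  · refine h (SimpleGraph.Adj.reachable ?_)
    rw [openGraph, SimpleGraph.fromEdgeSet_adj]
    refine ⟨⟨e, he, hxy⟩, ?_⟩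
    have : G.Adj x y := by rw [← SimpleGraph.mem_edgeSet, ← hxy]; exact e.2
    exact this.ne
  · obtain ⟨w⟩ := hxy
    induction w with
    | nil => exact S.refl _
    | cons hadj _ ih =>
      rw [openGraph, SimpleGraph.fromEdgeSet_adj] at hadj
      obtain ⟨⟨e, he, hxy⟩, -⟩ := hadj
      exact S.trans (h e he _ _ hxy) ih

theorem compSetoid_of_mem {ω : Config G} {e : G.edgeSet} (he : e ∈ ω) {x y : V}
    (hxy : (e : Sym2 V) = s(x, y)) : compSetoid G ξ ω x y :=
  (compSetoid_le_iff.1 le_rfl).1 e he x y hxy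

theorem compSetoid_of_rel {ω : Config G} {x y : V} (hxy : ξ x y) : compSetoid G ξ ω x y :=
  (compSetoid_le_iff.1 le_rfl).2 hxy

theorem compSetoid_mono : Monotone (compSetoid G ξ) := fun _ _ hω =>
  compSetoid_le_iff.2 ⟨fun _ he _ _ hxy => compSetoid_of_mem (hω he) hxy,
    fun _ _ => compSetoid_of_rel⟩

variable [DecidableEq V]

theorem compSetoid_insert {ω : Config G} {e : G.edgeSet} {a b : V} (hab : (e : Sym2 V) = s(a, b)) :
    compSetoid G ξ (insert e ω) = mergeSetoid (compSetoid G ξ (ω.erase e)) a b := by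
  set S := compSetoid G ξ (ω.erase e)
  set T := compSetoid G ξ (insert e ω)
  have hST : S ≤ T :=
    compSetoid_mono ((Finset.erase_subset _ _).trans (Finset.subset_insert _ _))
  have hT : T a b := compSetoid_of_mem (Finset.mem_insert_self _ _) hab
  apply le_antisymm
  · refine compSetoid_le_iff.2 ⟨fun f hf x y hxy => ?_, fun x y hxy => Or.inl
      (compSetoid_of_rel hxy)⟩
    by_cases hfe : f = e
    · subst hfe
      rw [hab, Sym2.eq_iff] at hxy
      rcases hxy with ⟨rfl, rfl⟩ | ⟨rfl, rfl⟩
      · exact Or.inr (Or.inl ⟨S.refl _, S.refl _⟩)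
      · exact Or.inr (Or.inr ⟨S.refl _, S.refl _⟩)
    · exact Or.inl (compSetoid_of_mem
        (Finset.mem_erase.2 ⟨hfe, Finset.mem_of_mem_insert_of_ne hf hfe⟩) hxy)
  · rintro x y (k | ⟨k, k'⟩ | ⟨k, k'⟩)
    · exact hST k
    · exact T.trans (hST k) (T.trans hT (hST k'))
    · exact T.trans (hST k) (T.trans (T.symm hT) (hST k'))

theorem numComp_erase_of_rel [Finite V] {ω : Config G} {e : G.edgeSet} {a b : V}
    (hab : (e : Sym2 V) = s(a, b)) (h : compSetoid G ξ (ω.erase e) a b) :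
    numComp G ξ (ω.erase e) = numComp G ξ (insert e ω) := by
  change Nat.card (Quotient (compSetoid G ξ _)) = Nat.card (Quotient (compSetoid G ξ _))
  rw [compSetoid_insert hab, mergeSetoid_eq_self h]

theorem numComp_erase_of_not_rel [Finite V] {ω : Config G} {e : G.edgeSet} {a b : V}
    (hab : (e : Sym2 V) = s(a, b)) (h : ¬ compSetoid G ξ (ω.erase e) a b) :
    numComp G ξ (ω.erase e) = numComp G ξ (insert e ω) + 1 := by
  change Nat.card (Quotient (compSetoid G ξ _)) = Nat.card (Quotient (compSetoid G ξ _)) + 1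
  rw [compSetoid_insert hab, card_quotient_mergeSetoid h]

variable [Fintype V] [DecidableRel G.Adj] {p q : ℝ}

theorem numComp_erase_ne_iff {ω : Config G} {e : G.edgeSet} {a b : V}
    (hab : (e : Sym2 V) = s(a, b)) :
    numComp G ξ (ω.erase e) ≠ numComp G ξ (insert e ω) ↔ ¬ compSetoid G ξ (ω.erase e) a b := by
  refine ⟨fun h hrel => h (numComp_erase_of_rel hab hrel), fun h => ?_⟩
  rw [numComp_erase_of_not_rel hab h]
  omega

theorem openProb_of_rel {ω : Config G} {e : G.edgeSet} {a b : V}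
    (hab : (e : Sym2 V) = s(a, b)) (h : compSetoid G ξ (ω.erase e) a b) :
    openProb G ξ p q ω e = p :=
  if_neg fun hne => (numComp_erase_ne_iff hab).1 hne h

theorem openProb_of_not_rel {ω : Config G} {e : G.edgeSet} {a b : V}
    (hab : (e : Sym2 V) = s(a, b)) (h : ¬ compSetoid G ξ (ω.erase e) a b) :
    openProb G ξ p q ω e = p / (q * (1 - p) + p) :=
  if_pos ((numComp_erase_ne_iff hab).2 h)

theorem one_le_bridge_denominator (hp1 : p ≤ 1) (hq : 1 ≤ q) : 1 ≤ q * (1 - p) + p := by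
  nlinarith

/-- Here `q ≥ 1` yields monotonicity: better connected ends make an edge more likely to open. -/
theorem bridge_openProb_le (hp0 : 0 ≤ p) (hp1 : p ≤ 1) (hq : 1 ≤ q) :
    p / (q * (1 - p) + p) ≤ p :=
  div_le_self hp0 (one_le_bridge_denominator hp1 hq)

theorem bridge_openProb_nonneg (hp0 : 0 ≤ p) (hp1 : p ≤ 1) (hq : 1 ≤ q) :
    0 ≤ p / (q * (1 - p) + p) :=
  div_nonneg hp0 (zero_le_one.trans (one_le_bridge_denominator hp1 hq))

theorem bridge_le_openProb (hp0 : 0 ≤ p) (hp1 : p ≤ 1) (hq : 1 ≤ q) (ω : Config G)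
    (e : G.edgeSet) : p / (q * (1 - p) + p) ≤ openProb G ξ p q ω e := by
  unfold openProb
  split_ifs
  · exact le_rfl
  · exact bridge_openProb_le hp0 hp1 hq

theorem openProb_le (hp0 : 0 ≤ p) (hp1 : p ≤ 1) (hq : 1 ≤ q) (ω : Config G)
    (e : G.edgeSet) : openProb G ξ p q ω e ≤ p := by
  unfold openProb
  split_ifs
  · exact bridge_openProb_le hp0 hp1 hq
  · exact le_rfl

/-- Comparison of the opening probabilities in two graphs, when one edge is less connected in
the first one. -/
theorem openProb_le_openProb (hp0 : 0 ≤ p) (hp1 : p ≤ 1) (hq : 1 ≤ q) {V' : Type*}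
    {G' : SimpleGraph V'} {ξ' : Setoid V'} [DecidableEq V'] [Fintype V'] [DecidableRel G'.Adj]
    {ω : Config G} {e : G.edgeSet} {ω' : Config G'} {e' : G'.edgeSet} {a b : V} {a' b' : V'}
    (hab : (e : Sym2 V) = s(a, b)) (hab' : (e' : Sym2 V') = s(a', b'))
    (h : compSetoid G ξ (ω.erase e) a b → compSetoid G' ξ' (ω'.erase e') a' b') :
    openProb G ξ p q ω e ≤ openProb G' ξ' p q ω' e' := by
  by_cases hrel : compSetoid G ξ (ω.erase e) a b
  · rw [openProb_of_rel hab hrel, openProb_of_rel hab' (h hrel)]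
  · rw [openProb_of_not_rel hab hrel]
    exact bridge_le_openProb hp0 hp1 hq ω' e'

theorem isMonotoneRate_openProb (hp0 : 0 ≤ p) (hp1 : p ≤ 1) (hq : 1 ≤ q) :
    IsMonotoneRate (openProb G ξ p q) where
  nonneg ω e := (bridge_openProb_nonneg hp0 hp1 hq).trans (bridge_le_openProb hp0 hp1 hq ω e)
  le_one ω e := (openProb_le hp0 hp1 hq ω e).trans hp1
  mono e ω ω' hω := by
    obtain ⟨a, b, hab⟩ := exists_sym2_eq (e : Sym2 V)
    exact openProb_le_openProb hp0 hp1 hq hab hab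
      fun h => compSetoid_mono (Finset.erase_subset_erase e hω) h

/-- Two cases are needed: at `p = 0` no edge ever opens, and at `p = 1` no edge ever closes. -/
theorem isElliptic_openProb (hp0 : 0 ≤ p) (hp1 : p ≤ 1) (hq : 1 ≤ q) :
    IsElliptic (openProb G ξ p q) := by
  rcases hp1.lt_or_eq with hp | rfl
  · exact ⟨1 - p, sub_pos.2 hp, Or.inl fun ω e => by
      linarith [openProb_le (G := G) (ξ := ξ) hp0 hp1 hq ω e]⟩
  · exact ⟨1, one_pos, Or.inr fun ω e => by
      simpa using bridge_le_openProb (G := G) (ξ := ξ) hp0 hp1 hq ω e⟩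

theorem rcWeight_nonneg (hp0 : 0 ≤ p) (hp1 : p ≤ 1) (hq : 1 ≤ q) (ω : Config G) :
    0 ≤ rcWeight G ξ p q ω := by
  have := sub_nonneg.2 hp1
  unfold rcWeight; positivity

theorem sum_rcWeight_pos (hp0 : 0 ≤ p) (hp1 : p ≤ 1) (hq : 1 ≤ q) :
    0 < ∑ ω : Config G, rcWeight G ξ p q ω := by
  have hq0 : 0 < q := one_pos.trans_le hq
  rcases hp1.lt_or_eq with hp | rfl
  · refine Finset.sum_pos' (fun ω _ => rcWeight_nonneg hp0 hp1 hq ω)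
      ⟨∅, Finset.mem_univ _, ?_⟩
    have := sub_pos.2 hp
    simp only [rcWeight, Finset.card_empty, pow_zero]
    positivity
  · refine Finset.sum_pos' (fun ω _ => rcWeight_nonneg hp0 hp1 hq ω)
      ⟨Finset.univ, Finset.mem_univ _, ?_⟩
    simp only [rcWeight, Finset.card_univ, Nat.sub_self, pow_zero]
    positivity

/-- Closing an edge trades a factor `p` for `1 - p`, with an extra factor `q` exactly when the edge
is a bridge. -/
theorem rcWeight_detailedBalance (hp1 : p ≤ 1) (hq : 1 ≤ q) (ω : Config G) (e : G.edgeSet) :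
    rcWeight G ξ p q (insert e ω) * (1 - openProb G ξ p q ω e) =
      rcWeight G ξ p q (ω.erase e) * openProb G ξ p q ω e := by
  obtain ⟨a, b, hab⟩ := exists_sym2_eq (e : Sym2 V)
  have hc1 : (insert e ω).card = (ω.erase e).card + 1 := by
    rw [← insert_erase_eq_insert, Finset.card_insert_of_notMem (Finset.notMem_erase e ω)]
  have hc2 : Fintype.card G.edgeSet - (ω.erase e).card =
      Fintype.card G.edgeSet - (insert e ω).card + 1 := by
    have := Finset.card_le_univ (insert e ω)
    omega
  have hd : q * (1 - p) + p ≠ 0 :=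
    (one_pos.trans_le (one_le_bridge_denominator hp1 hq)).ne'
  unfold rcWeight
  rw [hc2, hc1]
  by_cases hrel : compSetoid G ξ (ω.erase e) a b
  · rw [openProb_of_rel hab hrel, numComp_erase_of_rel hab hrel]
    ring
  · rw [openProb_of_not_rel hab hrel, numComp_erase_of_not_rel hab hrel]
    have h1 : 1 - p / (q * (1 - p) + p) = q * (1 - p) / (q * (1 - p) + p) := by
      rw [eq_div_iff hd, sub_mul, div_mul_cancel₀ _ hd]; ring
    rw [h1]
    ring

theorem rcDist_detailedBalance (hp1 : p ≤ 1) (hq : 1 ≤ q) (ω : Config G) (e : G.edgeSet) :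
    rcDist G ξ p q (insert e ω) * (1 - openProb G ξ p q ω e) =
      rcDist G ξ p q (ω.erase e) * openProb G ξ p q ω e := by
  unfold rcDist
  rw [div_mul_eq_mul_div, rcWeight_detailedBalance hp1 hq, div_mul_eq_mul_div]

end RandomCluster

/-- Resampling `e` only mixes the two configurations that differ at `e`, so invariance can be
checked on each such pair. -/
theorem dotProduct_edgeUpdate {E : Type*} [Fintype E] [DecidableEq E] {h : Finset E → E → ℝ}
    {μ : Finset E → ℝ} {e : E}
    (hinv : ∀ ω ω', ω.erase e = ω'.erase e → h ω e = h ω' e)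
    (hbal : ∀ ω, μ (insert e ω) * (1 - h ω e) = μ (ω.erase e) * h ω e) (f : Finset E → ℝ) :
    μ ⬝ᵥ edgeUpdate h e f = μ ⬝ᵥ f := by
  have hpair : ∀ F : Finset E → ℝ,
      ∑ ω, F ω = ∑ ω ∈ (Finset.univ.erase e).powerset, (F ω + F (insert e ω)) := by
    intro F
    rw [← Finset.powerset_univ, ← Finset.insert_erase (Finset.mem_univ e),
      Finset.sum_powerset_insert (Finset.notMem_erase e _), ← Finset.sum_add_distrib,
      Finset.insert_erase (Finset.mem_univ e)]
  simp only [dotProduct]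
  rw [hpair, hpair]
  refine Finset.sum_congr rfl fun ω hω => ?_
  have he : e ∉ ω := fun h => by simpa using Finset.mem_powerset.1 hω h
  have h1 : h (insert e ω) e = h ω e := hinv _ _ (by simp)
  have h2 := hbal ω
  rw [Finset.erase_eq_of_notMem he] at h2
  simp only [edgeUpdate_apply, h1, Finset.erase_insert he, Finset.insert_idem,
    Finset.erase_eq_of_notMem he]
  linear_combination (f ω - f (insert e ω)) * h2

theorem IsStationary.of_detailedBalance {E : Type*} [Fintype E] [DecidableEq E] [Nonempty E]
    {h : Finset E → E → ℝ} {μ : Finset E → ℝ} (h0 : ∀ ω, 0 ≤ μ ω) (h1 : ∑ ω, μ ω = 1)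
    (hinv : ∀ ω ω' e, ω.erase e = ω'.erase e → h ω e = h ω' e)
    (hbal : ∀ ω e, μ (insert e ω) * (1 - h ω e) = μ (ω.erase e) * h ω e) :
    IsStationary h μ where
  nonneg := h0
  sum_eq_one := h1
  dotProduct_heatBath f := by
    have hE : (Fintype.card E : ℝ) ≠ 0 := by exact_mod_cast Fintype.card_ne_zero
    rw [heatBath, LinearMap.smul_apply, dotProduct_smul, LinearMap.sum_apply, dotProduct_sum,
      Finset.sum_congr rfl fun e _ => dotProduct_edgeUpdate (fun ω ω' => hinv ω ω' e)
        (fun ω => hbal ω e) f]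
    simp [hE]

/-! ### From disagreement probabilities to the mixing time of the FK dynamics. -/

section Dynamics

variable {V : Type*} {G : SimpleGraph V} {ξ : Setoid V} [DecidableEq V] [Fintype V]
  [DecidableRel G.Adj] {p q : ℝ}

theorem isStationary_rcDist [Nonempty G.edgeSet] (hp0 : 0 ≤ p) (hp1 : p ≤ 1) (hq : 1 ≤ q) :
    IsStationary (openProb G ξ p q) (rcDist G ξ p q) := by
  refine IsStationary.of_detailedBalance
    (fun ω => div_nonneg (rcWeight_nonneg hp0 hp1 hq ω) (sum_rcWeight_pos hp0 hp1 hq).le) ?_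
    (fun ω ω' e hω => ?_) (fun ω e => rcDist_detailedBalance hp1 hq ω e)
  · simp only [rcDist]
    rw [← Finset.sum_div, div_self (sum_rcWeight_pos hp0 hp1 hq).ne']
  · unfold openProb
    rw [hω, ← insert_erase_eq_insert e ω, hω, insert_erase_eq_insert]

theorem fkMatrix_mulVec (f : Config G → ℝ) :
    (fkMatrix G ξ p q).mulVec f = heatBath (openProb G ξ p q) f := by
  ext ω
  rw [heatBath_apply]
  simp only [Matrix.mulVec, dotProduct, fkMatrix, Matrix.of_apply, mul_assoc]
  rw [← Finset.mul_sum]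
  congr 1
  simp only [Finset.sum_mul]
  rw [Finset.sum_comm]
  refine Finset.sum_congr rfl fun e _ => ?_
  simp only [add_mul, ite_mul, zero_mul, Finset.sum_add_distrib, Finset.sum_ite_eq',
    Finset.mem_univ, if_true, edgeUpdate_apply]

theorem fkMatrix_pow_mulVec (t : ℕ) (f : Config G → ℝ) :
    (fkMatrix G ξ p q ^ t).mulVec f = (heatBath (openProb G ξ p q) ^ t) f := by
  induction t generalizing f with
  | zero => simp
  | succ t ih =>
    rw [pow_succ, pow_succ, ← Matrix.mulVec_mulVec, fkMatrix_mulVec, ih, Module.End.mul_apply]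

/-- The event on which `α` is at least `β` attains the total variation distance. -/
theorem tvDist_eq_dotProduct {Ω : Type*} [Fintype Ω] {α β : Ω → ℝ} (h : ∑ x, α x = ∑ x, β x) :
    tvDist α β = α ⬝ᵥ (fun x => if β x ≤ α x then 1 else 0) -
      β ⬝ᵥ (fun x => if β x ≤ α x then 1 else 0) := by
  have key : ∀ x, |α x - β x| = 2 * ((α x - β x) * if β x ≤ α x then 1 else 0) -
      (α x - β x) := by
    intro x
    split_ifs with hx
    · rw [abs_of_nonneg (sub_nonneg.2 hx)]; ring
    · rw [abs_of_neg (by linarith)]; ring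
  rw [tvDist, Finset.sum_congr rfl fun x _ => key x, Finset.sum_sub_distrib,
    Finset.sum_sub_distrib, h, sub_self, sub_zero, ← Finset.mul_sum, ← mul_assoc]
  simp only [dotProduct, sub_mul, Finset.sum_sub_distrib]
  ring

theorem tvDist_fkMatrix_pow_le [Nonempty G.edgeSet] (hp0 : 0 ≤ p) (hp1 : p ≤ 1) (hq : 1 ≤ q)
    (t : ℕ) (ω : Config G) :
    tvDist ((fkMatrix G ξ p q ^ t) ω) (rcDist G ξ p q) ≤
      2 * ∑ e, disagreement (openProb G ξ p q) t e := by
  have hrow : ∀ f : Config G → ℝ, ((fkMatrix G ξ p q ^ t) ω) ⬝ᵥ f =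
      (heatBath (openProb G ξ p q) ^ t) f ω := fun f => congrFun (fkMatrix_pow_mulVec t f) ω
  have hst := isStationary_rcDist (G := G) (ξ := ξ) hp0 hp1 hq
  have hsum : ∑ ω', (fkMatrix G ξ p q ^ t) ω ω' = ∑ ω', rcDist G ξ p q ω' := by
    have := hrow fun _ => 1
    rw [heatBath_pow_const] at this
    rw [hst.sum_eq_one]
    simpa [dotProduct] using this
  rw [tvDist_eq_dotProduct hsum, hrow]
  exact heatBath_pow_sub_dotProduct_le (isMonotoneRate_openProb hp0 hp1 hq) hst
    (fun ω => by split_ifs <;> simp) t ω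

theorem fkMixingTime_le [Nonempty G.edgeSet] (hp0 : 0 ≤ p) (hp1 : p ≤ 1) (hq : 1 ≤ q) {t : ℕ}
    (ht : ∀ e, disagreement (openProb G ξ p q) t e ≤ 1 / (8 * Fintype.card G.edgeSet)) :
    fkMixingTime G ξ p q ≤ t := by
  refine sInf_le ⟨t, fun ω => (tvDist_fkMatrix_pow_le hp0 hp1 hq t ω).trans ?_, rfl⟩
  have hE : (0 : ℝ) < Fintype.card G.edgeSet := by exact_mod_cast Fintype.card_pos
  have := Finset.sum_le_sum fun e (_ : e ∈ Finset.univ) => ht e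
  rw [Finset.sum_const, Finset.card_univ, nsmul_eq_mul] at this
  calc _ ≤ 2 * (Fintype.card G.edgeSet * (1 / (8 * Fintype.card G.edgeSet)) : ℝ) := by linarith
    _ = 1 / 4 := by field_simp; norm_num

/-- A qualitative bound, for the finitely many tori too small for the main argument. -/
theorem exists_fkMixingTime_le [Nonempty G.edgeSet] (hp0 : 0 ≤ p) (hp1 : p ≤ 1) (hq : 1 ≤ q) :
    ∃ t : ℕ, fkMixingTime G ξ p q ≤ t := by
  have hst := isStationary_rcDist (G := G) (ξ := ξ) hp0 hp1 hq
  have hE : (0 : ℝ) < Fintype.card G.edgeSet := by exact_mod_cast Fintype.card_pos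
  have hε : (0 : ℝ) < 1 / (16 * Fintype.card G.edgeSet) := by positivity
  choose j hj using fun e : G.edgeSet => exists_abs_heatBath_pow_sub_le
    (isMonotoneRate_openProb (G := G) (ξ := ξ) hp0 hp1 hq) (isElliptic_openProb hp0 hp1 hq) hst
    (openInd e) hε
  refine ⟨Finset.univ.sup j, fkMixingTime_le hp0 hp1 hq fun e => ?_⟩
  have h1 := hj e (Finset.univ.sup j) (Finset.le_sup (Finset.mem_univ e))
  have h2 := abs_le.1 (h1 Finset.univ)
  have h3 := abs_le.1 (h1 ∅)
  have h4 : (1 : ℝ) / (8 * Fintype.card G.edgeSet) = 2 * (1 / (16 * Fintype.card G.edgeSet)) := by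
    field_simp; norm_num
  rw [h4, disagreement]
  linarith [h2.2, h3.1]

end Dynamics

/-! ### Boxes embedded in the torus and the comparison of boundary conditions. -/

section Lattice

variable {d n r : ℕ}

theorem lattice_adj_iff {x y : Fin d → ℤ} :
    (lattice d).Adj x y ↔ ∃ i, y = x + Pi.single i 1 ∨ x = y + Pi.single i 1 := by
  constructor
  · intro h
    have h : ∑ i, |x i - y i| = 1 := h
    obtain ⟨i, hi⟩ : ∃ i, x i - y i ≠ 0 := by
      by_contra! hcon
      simp [hcon] at h
    have h1 : 1 ≤ |x i - y i| := Int.one_le_abs hi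
    have h2 := Finset.add_sum_erase Finset.univ (fun i => |x i - y i|) (Finset.mem_univ i)
    have h3 : ∑ j ∈ Finset.univ.erase i, |x j - y j| = 0 :=
      le_antisymm (by linarith) (Finset.sum_nonneg fun _ _ => abs_nonneg _)
    have h4 : ∀ j, j ≠ i → x j = y j := fun j hj => by
      have := (Finset.sum_eq_zero_iff_of_nonneg fun _ _ => abs_nonneg _).1 h3 j
        (Finset.mem_erase.2 ⟨hj, Finset.mem_univ j⟩)
      exact sub_eq_zero.1 (abs_eq_zero.1 this)
    have h5 : |x i - y i| = 1 := by linarith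
    refine ⟨i, ?_⟩
    rcases (abs_eq (zero_le_one' ℤ)).1 h5 with h6 | h6
    · right
      ext j
      by_cases hj : j = i
      · subst hj; simp; omega
      · simp [hj, h4 j hj]
    · left
      ext j
      by_cases hj : j = i
      · subst hj; simp; omega
      · simp [hj, h4 j hj]
  · rintro ⟨i, rfl | rfl⟩
    · change ∑ j, |x j - (x + Pi.single i 1 : Fin d → ℤ) j| = 1
      simp [Pi.single_apply, apply_ite abs]
    · change ∑ j, |(y + Pi.single i 1 : Fin d → ℤ) j - y j| = 1
      simp [Pi.single_apply, apply_ite abs]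

theorem torus_adj_iff {x y : Fin d → ZMod n} :
    (torus d n).Adj x y ↔ x ≠ y ∧ ∃ i, y = x + Pi.single i 1 ∨ x = y + Pi.single i 1 := by
  rw [torus, SimpleGraph.circulantGraph_adj]
  simp only [Set.mem_range]
  refine and_congr_right fun _ => ⟨?_, ?_⟩
  · rintro (⟨i, hi⟩ | ⟨i, hi⟩)
    · exact ⟨i, Or.inr (by rw [hi]; abel)⟩
    · exact ⟨i, Or.inl (by rw [hi]; abel)⟩
  · rintro ⟨i, rfl | rfl⟩
    · exact Or.inr ⟨i, by abel⟩
    · exact Or.inl ⟨i, by abel⟩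

/-- The edge of the torus from `x` in direction `i`. -/
theorem exists_eq_add_single (e : (torus d n).edgeSet) :
    ∃ (x : Fin d → ZMod n) (i : Fin d), (e : Sym2 _) = s(x, x + Pi.single i 1) := by
  obtain ⟨e, he⟩ := e
  induction e using Sym2.inductionOn with
  | hf x y =>
    obtain ⟨-, i, rfl | rfl⟩ := torus_adj_iff.1 ((torus d n).mem_edgeSet.1 he)
    · exact ⟨x, i, rfl⟩
    · exact ⟨y, i, Sym2.eq_swap⟩

theorem card_torus_edgeSet_le [NeZero n] :
    Fintype.card (torus d n).edgeSet ≤ d * n ^ d := by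
  choose x i hxi using exists_eq_add_single (d := d) (n := n)
  have := Fintype.card_le_of_injective (fun e => (i e, x e)) fun e e' h => by
    rw [Prod.mk.injEq] at h
    apply Subtype.ext
    rw [hxi, hxi, h.1, h.2]
  simpa using this

theorem nonempty_torus_edgeSet (hd : 2 ≤ d) (hn : 2 ≤ n) : Nonempty (torus d n).edgeSet := by
  have : Fact (1 < n) := ⟨hn⟩
  refine ⟨⟨s(0, Pi.single ⟨0, by omega⟩ 1), ?_⟩⟩
  rw [SimpleGraph.mem_edgeSet, torus_adj_iff]
  refine ⟨fun h => ?_, ⟨0, by omega⟩, Or.inl (by simp)⟩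
  have := congrFun h ⟨0, by omega⟩
  simp at this

/-- The copy of a box in the torus, with the centre of the box at `x`. -/
def boxToTorus (d n r : ℕ) (x : Fin d → ZMod n) (v : box d r) : Fin d → ZMod n :=
  x + fun i => ((v : Fin d → ℤ) i : ZMod n)

theorem boxToTorus_add_single {x : Fin d → ZMod n} {u v : box d r} {i : Fin d}
    (h : (v : Fin d → ℤ) = (u : Fin d → ℤ) + Pi.single i 1) :
    boxToTorus d n r x v = boxToTorus d n r x u + Pi.single i 1 := by
  ext j
  simp only [boxToTorus, h, Pi.add_apply, Int.cast_add, Pi.single_apply, add_assoc]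
  split_ifs <;> simp

theorem boxToTorus_injective (hrn : r < n) (x : Fin d → ZMod n) :
    Function.Injective (boxToTorus d n r x) := by
  intro u v huv
  apply Subtype.ext
  ext i
  have h1 : (((u : Fin d → ℤ) i : ℤ) : ZMod n) = (((v : Fin d → ℤ) i : ℤ) : ZMod n) := by
    simpa [boxToTorus] using congrFun huv i
  have hu := mem_box.1 u.2 i
  have hv := mem_box.1 v.2 i
  have h2 : |((u : Fin d → ℤ) i) - ((v : Fin d → ℤ) i)| < n := by
    have h3 : (|((u : Fin d → ℤ) i : ℝ) - ((v : Fin d → ℤ) i)|) ≤ r :=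
      abs_le.2 ⟨by linarith [hu.1, hv.2], by linarith [hu.2, hv.1]⟩
    have h4 : |((u : Fin d → ℤ) i) - ((v : Fin d → ℤ) i)| ≤ r := by exact_mod_cast h3
    omega
  have h5 : (n : ℤ) ∣ (u : Fin d → ℤ) i - (v : Fin d → ℤ) i := by
    exact (ZMod.intCast_eq_intCast_iff_dvd_sub _ _ n).1 h1.symm
  exact sub_eq_zero.1 (Int.eq_zero_of_abs_lt_dvd h5 h2)

/-- The copy of a box in the torus, as a graph homomorphism. -/
def boxHom (hrn : r < n) (x : Fin d → ZMod n) : boxGraph d r →g torus d n where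
  toFun := boxToTorus d n r x
  map_rel' := by
    intro u v huv
    refine torus_adj_iff.2 ⟨(boxToTorus_injective hrn x).ne huv.ne, ?_⟩
    obtain ⟨i, h | h⟩ := lattice_adj_iff.1 (show (lattice d).Adj u v from huv)
    · exact ⟨i, Or.inl (boxToTorus_add_single h)⟩
    · exact ⟨i, Or.inr (boxToTorus_add_single h)⟩

/-- The edges of a copy of a box in the torus. -/
def boxEdgeEmbedding (hrn : r < n) (x : Fin d → ZMod n) :
    (boxGraph d r).edgeSet ↪ (torus d n).edgeSet :=
  ⟨(boxHom hrn x).mapEdgeSet,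
    SimpleGraph.Hom.mapEdgeSet.injective _ (boxToTorus_injective hrn x)⟩

theorem boxEdgeEmbedding_coe (hrn : r < n) (x : Fin d → ZMod n) {e : (boxGraph d r).edgeSet}
    {u v : box d r} (h : (e : Sym2 (box d r)) = s(u, v)) :
    (boxEdgeEmbedding hrn x e : Sym2 (Fin d → ZMod n)) =
      s(boxToTorus d n r x u, boxToTorus d n r x v) := by
  change Sym2.map (boxToTorus d n r x) (e : Sym2 (box d r)) = _
  rw [h, Sym2.map_mk]

/-- A vertex off the inner boundary has all its torus neighbours in the box, so paths can leave the
box only through the wired vertices. -/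
theorem exists_boxToTorus_eq_of_adj {x : Fin d → ZMod n} {u : box d r}
    (hu : u ∉ innerBoundary d r) {y : Fin d → ZMod n}
    (huy : (torus d n).Adj (boxToTorus d n r x u) y) :
    ∃ v, (boxGraph d r).Adj u v ∧ boxToTorus d n r x v = y := by
  have hin : ∀ w, (lattice d).Adj u w → w ∈ box d r := fun w hw => by
    by_contra hcon
    exact hu ⟨w, hcon, hw⟩
  obtain ⟨-, i, rfl | h⟩ := torus_adj_iff.1 huy
  · have hadj : (lattice d).Adj u ((u : Fin d → ℤ) + Pi.single i 1) :=
      lattice_adj_iff.2 ⟨i, Or.inl rfl⟩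
    exact ⟨⟨_, hin _ hadj⟩, hadj, boxToTorus_add_single rfl⟩
  · have hadj : (lattice d).Adj u ((u : Fin d → ℤ) - Pi.single i 1) :=
      lattice_adj_iff.2 ⟨i, Or.inr (by simp)⟩
    refine ⟨⟨_, hin _ hadj⟩, hadj, ?_⟩
    rw [boxToTorus_add_single (v := u) (u := ⟨_, hin _ hadj⟩) (i := i) (by simp)] at h
    exact add_right_cancel h

theorem nonempty_innerBoundary (hd : 0 < d) (r : ℕ) : (innerBoundary d r).Nonempty := by
  have hfl : (0 : ℝ) ≤ (⌊(r : ℝ) / 2⌋ : ℝ) := by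
    exact_mod_cast Int.floor_nonneg.2 (by positivity : (0 : ℝ) ≤ (r : ℝ) / 2)
  have hfl' := Int.floor_le ((r : ℝ) / 2)
  refine ⟨⟨fun _ => ⌊(r : ℝ) / 2⌋, mem_box.2 fun i => ⟨by linarith, hfl'⟩⟩,
    (fun _ => ⌊(r : ℝ) / 2⌋) + Pi.single ⟨0, hd⟩ 1, fun h => ?_,
    lattice_adj_iff.2 ⟨⟨0, hd⟩, Or.inl rfl⟩⟩
  have := (mem_box.1 h ⟨0, hd⟩).2
  simp only [Pi.add_apply, Pi.single_eq_same, Int.cast_add, Int.cast_one] at this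
  linarith [Int.lt_floor_add_one ((r : ℝ) / 2)]

theorem compSetoid_box_le_torus (hrn : r < n) (x : Fin d → ZMod n) (ω : Config (torus d n))
    (e : (boxGraph d r).edgeSet) {u v : box d r}
    (h : compSetoid (boxGraph d r) ⊥
      ((restrictConfig (boxEdgeEmbedding hrn x) ω).erase e) u v) :
    compSetoid (torus d n) ⊥ (ω.erase (boxEdgeEmbedding hrn x e))
      (boxToTorus d n r x u) (boxToTorus d n r x v) := by
  rw [← restrictConfig_erase] at h
  set ω' := ω.erase (boxEdgeEmbedding hrn x e)
  have : compSetoid (boxGraph d r) ⊥ (restrictConfig (boxEdgeEmbedding hrn x) ω') ≤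
      (compSetoid (torus d n) ⊥ ω').comap (boxToTorus d n r x) :=
    compSetoid_le_iff.2 ⟨fun f hf u v huv =>
      compSetoid_of_mem ((mem_restrictConfig _).1 hf) (boxEdgeEmbedding_coe hrn x huv), bot_le⟩
  exact this h

/-- Collapsing the outside of the box onto the wired boundary class maps each open torus edge to an
open box edge or to a single class. Connections in the torus thus survive in the wired box. -/
theorem compSetoid_torus_le_wired (hd : 0 < d) (hrn : r < n) (x : Fin d → ZMod n)
    (ω : Config (torus d n)) (e : (boxGraph d r).edgeSet) {u v : box d r}
    (h : compSetoid (torus d n) ⊥ (ω.erase (boxEdgeEmbedding hrn x e))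
      (boxToTorus d n r x u) (boxToTorus d n r x v)) :
    compSetoid (boxGraph d r) (wired d r)
      ((restrictConfig (boxEdgeEmbedding hrn x) ω).erase e) u v := by
  rw [← restrictConfig_erase]
  set ω' := ω.erase (boxEdgeEmbedding hrn x e)
  set S := compSetoid (boxGraph d r) (wired d r) (restrictConfig (boxEdgeEmbedding hrn x) ω')
  obtain ⟨b, hb⟩ := nonempty_innerBoundary hd r
  have hinj := boxToTorus_injective hrn x
  have hbdry : ∀ {u v}, u ∈ innerBoundary d r → v ∈ innerBoundary d r → S u v := fun hu hv =>
    compSetoid_of_rel (Or.inr ⟨hu, hv⟩)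
  -- the quotient map that sends everything outside the box to the class of the boundary
  set ψ : (Fin d → ZMod n) → Quotient S :=
    Function.extend (boxToTorus d n r x) (Quotient.mk S) fun _ => Quotient.mk S b with hψ
  have hψin : ∀ u, ψ (boxToTorus d n r x u) = Quotient.mk S u := fun u => hinj.extend_apply _ _ u
  have hψout : ∀ y, (¬ ∃ u, boxToTorus d n r x u = y) → ψ y = Quotient.mk S b := fun y hy =>
    Function.extend_apply' _ _ _ hy
  have hle : compSetoid (torus d n) ⊥ ω' ≤ Setoid.ker ψ := by
    refine compSetoid_le_iff.2 ⟨fun f hf y z hyz => ?_, bot_le⟩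
    rw [Setoid.ker_def]
    have hadj : (torus d n).Adj y z := by
      rw [← SimpleGraph.mem_edgeSet, ← hyz]; exact f.2
    by_cases hy : ∃ u, boxToTorus d n r x u = y
    · obtain ⟨u, rfl⟩ := hy
      rw [hψin]
      by_cases hz : ∃ v, boxToTorus d n r x v = z
      · obtain ⟨v, rfl⟩ := hz
        rw [hψin]
        refine Quotient.sound (s := S) ?_
        by_cases huv : (boxGraph d r).Adj u v
        · refine compSetoid_of_mem (e := (⟨s(u, v), huv⟩ : (boxGraph d r).edgeSet)) ((mem_restrictConfig _).2 ?_) rfl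
          convert hf
          exact Subtype.ext ((boxEdgeEmbedding_coe hrn x rfl).trans hyz.symm)
        -- This case is an edge that wraps around the torus and joins opposite faces of the box.
        · have hu : u ∈ innerBoundary d r := by
            by_contra hu
            obtain ⟨w, hw, hwv⟩ := exists_boxToTorus_eq_of_adj hu hadj
            exact huv (hinj hwv ▸ hw)
          have hv : v ∈ innerBoundary d r := by
            by_contra hv
            obtain ⟨w, hw, hwu⟩ := exists_boxToTorus_eq_of_adj hv hadj.symm
            exact huv (hinj hwu ▸ hw.symm)
          exact hbdry hu hv
      · rw [hψout z hz]
        refine Quotient.sound (s := S) (hbdry ?_ hb)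
        by_contra hu
        obtain ⟨w, -, hw⟩ := exists_boxToTorus_eq_of_adj hu hadj
        exact hz ⟨w, hw⟩
    · rw [hψout y hy]
      by_cases hz : ∃ v, boxToTorus d n r x v = z
      · obtain ⟨v, rfl⟩ := hz
        rw [hψin]
        refine Quotient.sound (s := S) (hbdry hb ?_)
        by_contra hv
        obtain ⟨w, -, hw⟩ := exists_boxToTorus_eq_of_adj hv hadj.symm
        exact hy ⟨w, hw⟩
      · rw [hψout z hz]
  have := hle h
  rw [Setoid.ker_def, hψin, hψin] at this
  exact Quotient.exact this

variable {p q : ℝ}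

theorem openProb_torus_le_wired [NeZero n] (hp0 : 0 ≤ p) (hp1 : p ≤ 1) (hq : 1 ≤ q) (hd : 0 < d)
    (hrn : r < n) (x : Fin d → ZMod n) (ω : Config (torus d n)) (e : (boxGraph d r).edgeSet) :
    openProb (torus d n) ⊥ p q ω (boxEdgeEmbedding hrn x e) ≤
      openProb (boxGraph d r) (wired d r) p q (restrictConfig (boxEdgeEmbedding hrn x) ω) e := by
  obtain ⟨u, v, huv⟩ := exists_sym2_eq (e : Sym2 (box d r))
  exact openProb_le_openProb hp0 hp1 hq (boxEdgeEmbedding_coe hrn x huv) huv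
    (compSetoid_torus_le_wired hd hrn x ω e)

theorem openProb_free_le_torus [NeZero n] (hp0 : 0 ≤ p) (hp1 : p ≤ 1) (hq : 1 ≤ q)
    (hrn : r < n) (x : Fin d → ZMod n) (ω : Config (torus d n)) (e : (boxGraph d r).edgeSet) :
    openProb (boxGraph d r) ⊥ p q (restrictConfig (boxEdgeEmbedding hrn x) ω) e ≤
      openProb (torus d n) ⊥ p q ω (boxEdgeEmbedding hrn x e) := by
  obtain ⟨u, v, huv⟩ := exists_sym2_eq (e : Sym2 (box d r))
  exact openProb_le_openProb hp0 hp1 hq huv (boxEdgeEmbedding_coe hrn x huv)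
    (compSetoid_box_le_torus hrn x ω e)

theorem zero_mem_box {ℓ : ℝ} (hℓ : 0 ≤ ℓ) : (0 : Fin d → ℤ) ∈ box d ℓ :=
  mem_box.2 fun _ => by
    rw [Pi.zero_apply, Int.cast_zero]; constructor <;> linarith

theorem single_mem_box {ℓ : ℝ} (hℓ : 2 ≤ ℓ) (i : Fin d) : (Pi.single i 1 : Fin d → ℤ) ∈ box d ℓ :=
  mem_box.2 fun j => by
    rw [Pi.single_apply]; split_ifs <;> constructor <;> push_cast <;> linarith

/-- The edge at the centre of the box, in direction `i`. -/
def centralEdge (hr : 4 ≤ r) (i : Fin d) : (boxGraph d r).edgeSet :=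
  ⟨s(⟨0, zero_mem_box (Nat.cast_nonneg r)⟩,
      ⟨Pi.single i 1, single_mem_box (by exact_mod_cast (by omega : 2 ≤ r)) i⟩),
    lattice_adj_iff.2 ⟨i, Or.inl (zero_add _).symm⟩⟩

/-- The condition `4 ≤ r` makes the inner box contain `[-1, 1]^d`, so weak spatial mixing applies to
this edge. -/
theorem centralEdge_mem_innerEdges (hr : 4 ≤ r) (i : Fin d) :
    centralEdge hr i ∈ innerEdges d r (r / 2) := by
  have hr' : (4 : ℝ) ≤ r := by exact_mod_cast hr
  rw [innerEdges, Finset.mem_filter]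
  refine ⟨Finset.mem_univ _, fun v hv => ?_⟩
  rcases Sym2.mem_iff.1 hv with rfl | rfl
  · exact zero_mem_box (by positivity)
  · exact single_mem_box (by linarith) i

/-- By translation every torus edge is the centre of some copy of the box, which makes all bounds
uniform in the edge. -/
theorem exists_boxEdgeEmbedding_centralEdge (hr : 4 ≤ r) (hrn : r < n)
    (e : (torus d n).edgeSet) :
    ∃ x i, boxEdgeEmbedding hrn x (centralEdge hr i) = e := by
  obtain ⟨x, i, hxi⟩ := exists_eq_add_single e
  refine ⟨x, i, Subtype.ext ?_⟩
  rw [hxi]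
  refine (boxEdgeEmbedding_coe hrn x rfl).trans ?_
  have h0 : boxToTorus d n r x ⟨0, zero_mem_box (Nat.cast_nonneg r)⟩ = x := by
    ext j; simp [boxToTorus]
  have h1 : ∀ h, boxToTorus d n r x ⟨Pi.single i 1, h⟩ = x + Pi.single i 1 := fun h => by
    rw [boxToTorus_add_single (u := ⟨0, zero_mem_box (Nat.cast_nonneg r)⟩) (i := i)
      (zero_add _).symm, h0]
  rw [h0, h1]

/-- Edges are counted crudely by ordered pairs of vertices; only polynomial growth matters. -/
theorem card_boxGraph_edgeSet_le (d r : ℕ) :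
    Fintype.card (boxGraph d r).edgeSet ≤ (r + 1) ^ (2 * d) := by
  have h1 : Fintype.card (box d r) ≤ (r + 1) ^ d := by
    rw [Fintype.card_coe, box, Fintype.card_piFinset, Finset.prod_const, Finset.card_univ,
      Fintype.card_fin]
    refine Nat.pow_le_pow_left ?_ d
    rw [Int.card_Icc, Int.toNat_le]
    have h2 := Int.floor_le ((r : ℝ) / 2)
    have h3 := Int.le_ceil (-((r : ℝ) / 2))
    have h4 : ((⌊(r : ℝ) / 2⌋ + 1 - ⌈-((r : ℝ) / 2)⌉ : ℤ) : ℝ) ≤ ((r + 1 : ℕ) : ℤ) := by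
      push_cast; linarith
    exact_mod_cast h4
  choose a b hab using fun e : (boxGraph d r).edgeSet => exists_sym2_eq (e : Sym2 (box d r))
  have h2 := Fintype.card_le_of_injective (fun e => (a e, b e)) fun e e' h => by
    rw [Prod.mk.injEq] at h
    apply Subtype.ext
    rw [hab, hab, h.1, h.2]
  rw [Fintype.card_prod] at h2
  calc _ ≤ _ := h2
    _ ≤ (r + 1) ^ d * (r + 1) ^ d := Nat.mul_le_mul h1 h1
    _ = _ := by rw [← pow_add, two_mul]

end Lattice

/-! ### From total variation of marginals to single-edge probabilities. -/

section Marginal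

variable {V : Type*} {G : SimpleGraph V} [DecidableEq V] [Fintype V] [DecidableRel G.Adj]

theorem marginal_dotProduct_openInd {F : Finset G.edgeSet} {e : G.edgeSet} (he : e ∈ F)
    (μ : Config G → ℝ) : marginal G F μ ⬝ᵥ openInd e = μ ⬝ᵥ openInd e := by
  simp only [dotProduct, marginal]
  rw [← Finset.sum_fiberwise Finset.univ (fun ω : Config G => ω ∩ F)
    (fun ω => μ ω * openInd e ω)]
  refine Finset.sum_congr rfl fun η _ => ?_
  rw [Finset.sum_mul]
  refine Finset.sum_congr rfl fun ω hω => ?_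
  rw [← (Finset.mem_filter.1 hω).2]
  simp [openInd, he]

theorem dotProduct_openInd_sub_le {F : Finset G.edgeSet} {e : G.edgeSet} (he : e ∈ F)
    (μ ν : Config G → ℝ) : μ ⬝ᵥ openInd e - ν ⬝ᵥ openInd e ≤
      2 * tvDist (marginal G F μ) (marginal G F ν) := by
  rw [← marginal_dotProduct_openInd he μ, ← marginal_dotProduct_openInd he ν, ← sub_dotProduct,
    tvDist, ← mul_assoc, mul_one_div_cancel two_ne_zero, one_mul]
  refine Finset.sum_le_sum fun η _ => ?_
  refine (le_abs_self _).trans ?_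
  rw [abs_mul, Pi.sub_apply]
  refine mul_le_of_le_one_right (abs_nonneg _) ?_
  rw [abs_of_nonneg (openInd_nonneg e η)]
  exact openInd_le_one e η

end Marginal

/-! ### Decay of disagreement on the torus and the choice of time scales. -/

section Torus

variable {d n r : ℕ} {p q C : ℝ}

/-- The bound of weak spatial mixing, with an explicit constant. -/
def WeakSpatialMixingWith (d : ℕ) (p q C : ℝ) : Prop :=
  ∀ r : ℕ, tvDist
    (marginal (boxGraph d r) (innerEdges d r (r / 2)) (rcDist (boxGraph d r) (wired d r) p q))
    (marginal (boxGraph d r) (innerEdges d r (r / 2)) (rcDist (boxGraph d r) ⊥ p q))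
    ≤ C * Real.exp (-(r / C))

theorem WeakSpatialMixingWith.centralEdge_le (h : WeakSpatialMixingWith d p q C) (hr : 4 ≤ r)
    (i : Fin d) :
    rcDist (boxGraph d r) (wired d r) p q ⬝ᵥ openInd (centralEdge hr i) -
      rcDist (boxGraph d r) ⊥ p q ⬝ᵥ openInd (centralEdge hr i) ≤
        2 * (C * Real.exp (-(r / C))) :=
  (dotProduct_openInd_sub_le (centralEdge_mem_innerEdges hr i) _ _).trans
    (mul_le_mul_of_nonneg_left (h r) two_pos.le)

/-- The constant `4` is the `2` of `disagreement_add_le` times the `2` of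
`dotProduct_openInd_sub_le`. -/
theorem torus_disagreement_add_le [NeZero n] [Nonempty (torus d n).edgeSet] (hp0 : 0 ≤ p)
    (hp1 : p ≤ 1) (hq : 1 ≤ q) (h : WeakSpatialMixingWith d p q C) (hr : 4 ≤ r) (hrn : r < n)
    {s t : ℕ} {a b : ℝ}
    (ha : ∀ e, disagreement (openProb (torus d n) ⊥ p q) s e ≤ a)
    (hb : ∀ e, disagreement (openProb (torus d n) ⊥ p q) t e ≤ b) (e : (torus d n).edgeSet) :
    disagreement (openProb (torus d n) ⊥ p q) (s + t) e ≤
      ((r : ℝ) + 1) ^ (2 * d) * (a * b) + 4 * (C * Real.exp (-(r / C))) := by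
  have hh := isMonotoneRate_openProb (G := torus d n) (ξ := ⊥) hp0 hp1 hq
  have ha0 : 0 ≤ a := (disagreement_nonneg hh s e).trans (ha e)
  have hb0 : 0 ≤ b := (disagreement_nonneg hh t e).trans (hb e)
  obtain ⟨x, i, rfl⟩ := exists_boxEdgeEmbedding_centralEdge hr hrn e
  have : Nonempty (boxGraph d r).edgeSet := ⟨centralEdge hr i⟩
  have h1 := disagreement_add_le (boxEdgeEmbedding hrn x) hh (isStationary_rcDist hp0 hp1 hq)
    (isMonotoneRate_openProb (G := boxGraph d r) (ξ := wired d r) hp0 hp1 hq)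
    (isMonotoneRate_openProb (G := boxGraph d r) (ξ := ⊥) hp0 hp1 hq)
    (isElliptic_openProb hp0 hp1 hq) (isElliptic_openProb hp0 hp1 hq)
    (isStationary_rcDist hp0 hp1 hq) (isStationary_rcDist hp0 hp1 hq)
    (openProb_torus_le_wired hp0 hp1 hq i.pos hrn x) (openProb_free_le_torus hp0 hp1 hq hrn x)
    ha hb (centralEdge hr i)
  have h2 := h.centralEdge_le hr i
  have h3 : (Fintype.card (boxGraph d r).edgeSet : ℝ) ≤ ((r : ℝ) + 1) ^ (2 * d) := by
    exact_mod_cast card_boxGraph_edgeSet_le d r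
  have h4 := mul_le_mul_of_nonneg_right h3 (mul_nonneg ha0 hb0)
  linarith

theorem tendsto_exp_neg_div (hC : 0 < C) :
    Filter.Tendsto (fun r : ℕ => Real.exp (-((r : ℝ) / C))) Filter.atTop (nhds 0) :=
  Real.tendsto_exp_neg_atTop_nhds_zero.comp
    (tendsto_natCast_atTop_atTop.atTop_div_const hC)

/-- After a number of sweeps that does not depend on the size of the torus, the disagreement
probabilities are small. -/
theorem exists_torus_disagreement_le (hd : 2 ≤ d) (hp0 : 0 ≤ p) (hp1 : p ≤ 1) (hq : 1 ≤ q)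
    (hC : 0 < C) (h : WeakSpatialMixingWith d p q C) {δ : ℝ} (hδ : 0 < δ) :
    ∃ r A : ℕ, ∀ (n : ℕ) [NeZero n], r < n → ∀ e : (torus d n).edgeSet,
      disagreement (openProb (torus d n) ⊥ p q) (A * Fintype.card (torus d n).edgeSet) e ≤ δ := by
  -- The budget `δ` is split as `δ/2` for the boundary influence, `δ/8` for each of the two limiting
  -- errors, and `δ/4` for the transient.
  obtain ⟨r, hr1, hr⟩ : ∃ r : ℕ, 2 * (C * Real.exp (-((r : ℝ) / C))) ≤ δ / 2 ∧ 4 ≤ r := by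
    have : Filter.Tendsto (fun r : ℕ => 2 * (C * Real.exp (-((r : ℝ) / C))))
        Filter.atTop (nhds 0) := by
      simpa using ((tendsto_exp_neg_div hC).const_mul C).const_mul 2
    exact ((this.eventually_le_const (half_pos hδ)).and (Filter.eventually_ge_atTop 4)).exists
  have hne : Nonempty (boxGraph d r).edgeSet := ⟨centralEdge hr ⟨0, by omega⟩⟩
  have hε : 0 < δ / 8 := by positivity
  have hmw := isMonotoneRate_openProb (G := boxGraph d r) (ξ := wired d r) hp0 hp1 hq
  have hmf := isMonotoneRate_openProb (G := boxGraph d r) (ξ := ⊥) hp0 hp1 hq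
  choose Bw hBw0 hBw using fun i : Fin d => exists_abs_lazyHeatBath_pow_sub_le hmw
    (isElliptic_openProb hp0 hp1 hq) (isStationary_rcDist hp0 hp1 hq)
    (openInd (centralEdge hr i)) hε
  choose Bf hBf0 hBf using fun i : Fin d => exists_abs_lazyHeatBath_pow_sub_le hmf
    (isElliptic_openProb hp0 hp1 hq) (isStationary_rcDist hp0 hp1 hq)
    (openInd (centralEdge hr i)) hε
  set B : ℝ := ∑ i, (Bw i + Bf i) with hB
  obtain ⟨A, hA⟩ : ∃ A : ℕ, B * Real.exp (-((A : ℝ) / 2)) ≤ δ / 4 := by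
    have : Filter.Tendsto (fun A : ℕ => B * Real.exp (-((A : ℝ) / 2)))
        Filter.atTop (nhds 0) := by
      simpa using (tendsto_exp_neg_div two_pos).const_mul B
    exact (this.eventually_le_const (by positivity)).exists
  refine ⟨r, A, fun n _ hrn e => ?_⟩
  obtain ⟨x, i, rfl⟩ := exists_boxEdgeEmbedding_centralEdge hr hrn e
  have hneT : Nonempty (torus d n).edgeSet := ⟨boxEdgeEmbedding hrn x (centralEdge hr i)⟩
  have hh := isMonotoneRate_openProb (G := torus d n) (ξ := ⊥) hp0 hp1 hq
  set κ := updateSpeed (boxGraph d r).edgeSet (torus d n).edgeSet with hκ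
  have hκ0 : 0 ≤ κ := updateSpeed_nonneg
  have hκ1 : κ ≤ 1 := updateSpeed_le_one (boxEdgeEmbedding hrn x)
  set t := A * Fintype.card (torus d n).edgeSet with ht
  have h1 := disagreement_le_lazyHeatBath (boxEdgeEmbedding hrn x) hh hmw hmf
    (openProb_torus_le_wired hp0 hp1 hq i.pos hrn x) (openProb_free_le_torus hp0 hp1 hq hrn x)
    t (centralEdge hr i)
  have h2 := (abs_le.1 (hBw i κ hκ0 hκ1 t
    (restrictConfig (boxEdgeEmbedding hrn x) Finset.univ))).2
  have h3 := (abs_le.1 (hBf i κ hκ0 hκ1 t (restrictConfig (boxEdgeEmbedding hrn x) ∅))).1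
  have h4 := h.centralEdge_le hr i
  -- The expected number of updates in the box is `κ t = A |E_box|`, in which `n` has cancelled.
  have h5 : (1 - κ / 2) ^ t ≤ Real.exp (-((A : ℝ) / 2)) := by
    have hE : (0 : ℝ) < Fintype.card (torus d n).edgeSet := by exact_mod_cast Fintype.card_pos
    have hE' : (1 : ℝ) ≤ Fintype.card (boxGraph d r).edgeSet := by
      exact_mod_cast Fintype.card_pos
    calc (1 - κ / 2) ^ t ≤ Real.exp (-(κ / 2)) ^ t :=
          pow_le_pow_left₀ (by linarith) (by linarith [Real.add_one_le_exp (-(κ / 2))]) t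
      _ = Real.exp (-(A * Fintype.card (boxGraph d r).edgeSet / 2)) := by
          rw [← Real.exp_nat_mul, ht, hκ, updateSpeed]
          congr 1
          push_cast
          field_simp
      _ ≤ _ := by
          apply Real.exp_le_exp.2
          have := mul_le_mul_of_nonneg_left hE' (Nat.cast_nonneg (α := ℝ) A)
          linarith
  have h6 : Bw i + Bf i ≤ B :=
    Finset.single_le_sum (f := fun i => Bw i + Bf i)
      (fun i _ => add_nonneg (hBw0 i) (hBf0 i)) (Finset.mem_univ i)
  have h7 : (Bw i + Bf i) * (1 - κ / 2) ^ t ≤ B * Real.exp (-((A : ℝ) / 2)) :=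
    mul_le_mul h6 h5 (pow_nonneg (by linarith) t)
      ((add_nonneg (hBw0 i) (hBf0 i)).trans h6)
  linarith

/-- The numerical inequality behind the doubling of the time scale. -/
theorem doubling_inequality (hC : 0 < C) {D : ℕ} {K x : ℝ} (hK : 4 * C ≤ K) (hK1 : 1 ≤ K)
    (hx : 1 ≤ x) (hexp : 16 * C * (8 * (K * x)) ^ D ≤ Real.exp (K * x / (2 * C))) :
    (K * x + 1) ^ D * (1 / (2 * (4 * K) ^ D) * (x ^ D)⁻¹ * Real.exp (-x) *
        (1 / (2 * (4 * K) ^ D) * (x ^ D)⁻¹ * Real.exp (-x))) +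
      4 * (C * Real.exp (-(K * x / C))) ≤
      1 / (2 * (4 * K) ^ D) * ((2 * x) ^ D)⁻¹ * Real.exp (-(2 * x)) := by
  have hx0 : 0 < x := by linarith
  have hK0 : 0 < K := by linarith
  have hE : Real.exp (-(2 * x)) = Real.exp (-x) * Real.exp (-x) := by
    rw [← Real.exp_add]; congr 1; ring
  have hKx : 1 ≤ K * x := one_le_mul_of_one_le_of_one_le hK1 hx
  have h1 : (K * x + 1) ^ D ≤ (2 * K * x) ^ D :=
    pow_le_pow_left₀ (by positivity) (by linarith) D
  -- The factor `x ^ (-D)` and the constant `2 (4K)^D` are chosen so that squaring, times the bound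
  -- `(2Kx)^D` on the box volume, gives exactly half of the target at `2x`.
  have h2 : (K * x + 1) ^ D * (1 / (2 * (4 * K) ^ D) * (x ^ D)⁻¹ * Real.exp (-x) *
        (1 / (2 * (4 * K) ^ D) * (x ^ D)⁻¹ * Real.exp (-x))) ≤
      1 / 2 * (1 / (2 * (4 * K) ^ D) * ((2 * x) ^ D)⁻¹ * Real.exp (-(2 * x))) := by
    refine (mul_le_mul_of_nonneg_right h1 (by positivity)).trans (le_of_eq ?_)
    rw [hE, show (4 : ℝ) * K = 2 * 2 * K by ring]
    simp only [mul_pow]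
    field_simp
  have h3 : 4 * (C * Real.exp (-(K * x / C))) ≤
      1 / 2 * (1 / (2 * (4 * K) ^ D) * ((2 * x) ^ D)⁻¹ * Real.exp (-(2 * x))) := by
    -- The exponent `K x / C` is split in two: one half absorbs the polynomial through `hexp`, the
    -- other gives `exp (-2x)` because `K ≥ 4C`.
    have h4 : 2 * x ≤ K * x / (2 * C) := by
      rw [le_div_iff₀ (by positivity)]
      nlinarith [mul_le_mul_of_nonneg_right hK hx0.le]
    have h5 : Real.exp (-(K * x / C)) =
        Real.exp (-(K * x / (2 * C))) * Real.exp (-(K * x / (2 * C))) := by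
      rw [← Real.exp_add]; congr 1; field_simp; ring
    have h6 : Real.exp (-(K * x / (2 * C))) ≤ Real.exp (-(2 * x)) :=
      Real.exp_le_exp.2 (neg_le_neg h4)
    have h7 : 16 * C * (8 * (K * x)) ^ D * Real.exp (-(K * x / (2 * C))) ≤ 1 := by
      have := mul_le_mul_of_nonneg_right hexp (Real.exp_pos (-(K * x / (2 * C)))).le
      rwa [← Real.exp_add, add_neg_cancel, Real.exp_zero] at this
    have h8 : 1 / 2 * (1 / (2 * (4 * K) ^ D) * ((2 * x) ^ D)⁻¹ * Real.exp (-(2 * x))) =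
        Real.exp (-(2 * x)) / (4 * (8 * (K * x)) ^ D) := by
      rw [show 8 * (K * x) = 4 * K * (2 * x) by ring, mul_pow (4 * K)]
      field_simp
      norm_num
    rw [h8, le_div_iff₀ (by positivity), h5]
    calc _ = 16 * C * (8 * (K * x)) ^ D * Real.exp (-(K * x / (2 * C))) *
          Real.exp (-(K * x / (2 * C))) := by ring
      _ ≤ 1 * Real.exp (-(2 * x)) := mul_le_mul h7 h6 (Real.exp_pos _).le zero_le_one
      _ = _ := one_mul _
  linarith

theorem exists_doubling_scale (hC : 0 < C) (D : ℕ) :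
    ∃ K : ℕ, 4 ≤ K ∧ 4 * C ≤ K ∧ ∀ x : ℝ, 1 ≤ x →
      16 * C * (8 * (K * x)) ^ D ≤ Real.exp (K * x / (2 * C)) := by
  have h1 := (isLittleO_pow_exp_pos_mul_atTop D (b := 1 / (2 * C)) (by positivity)).bound
    (c := 1 / (16 * C * 8 ^ D)) (by positivity)
  obtain ⟨Y, hY⟩ := Filter.eventually_atTop.1 h1
  obtain ⟨K, hK⟩ := exists_nat_ge (max Y (max 4 (4 * C)))
  have hK4 : (4 : ℝ) ≤ K := ((le_max_left _ _).trans (le_max_right _ _)).trans hK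
  refine ⟨K, by exact_mod_cast hK4, ((le_max_right _ _).trans (le_max_right _ _)).trans hK,
    fun x hx => ?_⟩
  have hy : (K : ℝ) ≤ K * x := le_mul_of_one_le_right (by positivity) hx
  have h2 := hY (K * x) (((le_max_left _ _).trans hK).trans hy)
  have hpos : (0 : ℝ) ≤ K * x := by positivity
  rw [Real.norm_of_nonneg (by positivity), Real.norm_of_nonneg (Real.exp_pos _).le,
    one_div_mul_eq_div, one_div_mul_eq_div, le_div_iff₀ (by positivity)] at h2
  calc _ = (K * x) ^ D * (16 * C * 8 ^ D) := by rw [mul_pow 8]; ring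
    _ ≤ _ := h2

/-- Along a dyadic sequence of times the disagreement probabilities decay exponentially, as long
as the corresponding boxes fit into the torus. -/
theorem torus_disagreement_pow_two_le [NeZero n] [Nonempty (torus d n).edgeSet] (hp0 : 0 ≤ p)
    (hp1 : p ≤ 1) (hq : 1 ≤ q) (hC : 0 < C) (h : WeakSpatialMixingWith d p q C) {K : ℕ}
    (hK : 4 ≤ K) (hKC : 4 * C ≤ K)
    (hexp : ∀ x : ℝ, 1 ≤ x → 16 * C * (8 * (K * x)) ^ (2 * d) ≤ Real.exp (K * x / (2 * C)))
    {t₀ : ℕ} (hbase : ∀ e, disagreement (openProb (torus d n) ⊥ p q) t₀ e ≤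
      1 / (2 * (4 * (K : ℝ)) ^ (2 * d)) * Real.exp (-1)) (k : ℕ) (hk : K * 2 ^ k < n)
    (e : (torus d n).edgeSet) :
    disagreement (openProb (torus d n) ⊥ p q) (2 ^ k * t₀) e ≤
      1 / (2 * (4 * (K : ℝ)) ^ (2 * d)) * (((2 : ℝ) ^ k) ^ (2 * d))⁻¹ *
        Real.exp (-(2 : ℝ) ^ k) := by
  induction k generalizing e with
  | zero => simpa using hbase e
  | succ k ih =>
    have hlt : K * 2 ^ k < n := lt_of_le_of_lt
      (Nat.mul_le_mul_left K (Nat.pow_le_pow_right two_pos k.le_succ)) hk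
    have h1 := ih hlt
    have hr : 4 ≤ K * 2 ^ k := hK.trans (Nat.le_mul_of_pos_right K (by positivity))
    have h2 := torus_disagreement_add_le hp0 hp1 hq h hr hlt h1 h1 e
    have h3 := doubling_inequality hC (D := 2 * d) hKC
      (by exact_mod_cast (by omega : 1 ≤ K)) (x := 2 ^ k) (one_le_pow₀ one_le_two)
      (hexp _ (one_le_pow₀ one_le_two))
    rw [← two_mul, ← mul_assoc, ← pow_succ'] at h2
    rw [← pow_succ'] at h3
    refine h2.trans (le_trans (le_of_eq ?_) h3)
    push_cast
    ring

theorem exists_torus_mixingTime_le (hd : 2 ≤ d) (hp0 : 0 ≤ p) (hp1 : p ≤ 1) (hq : 1 ≤ q)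
    (hC : 0 < C) (h : WeakSpatialMixingWith d p q C) :
    ∃ (n₀ : ℕ) (A : ℝ), 0 < A ∧ ∀ (n : ℕ) [NeZero n], n₀ ≤ n → ∃ t : ℕ,
      fkMixingTime (torus d n) ⊥ p q ≤ t ∧
        (t : ℝ) ≤ A * ((n ^ d : ℕ) : ℝ) * Real.log ((n ^ d : ℕ) : ℝ) := by
  obtain ⟨K, hK4, hKC, hexp⟩ := exists_doubling_scale hC (2 * d)
  have hK0 : (0 : ℝ) < K := by exact_mod_cast (by omega : 0 < K)
  -- The target is the value of the dyadic bound at scale `2 ^ 0`.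
  obtain ⟨r, A, hA⟩ := exists_torus_disagreement_le hd hp0 hp1 hq hC h
    (δ := 1 / (2 * (4 * (K : ℝ)) ^ (2 * d)) * Real.exp (-1)) (by positivity)
  have hd0 : (0 : ℝ) < d := by exact_mod_cast (by omega : 0 < d)
  have hd2 : (2 : ℝ) ≤ d := by exact_mod_cast hd
  -- Since `log n = o(n)`, boxes of side of order `log N` eventually fit into the torus.
  have hsmall : ∀ᶠ n : ℕ in Filter.atTop,
      (K : ℝ) * (2 * (Real.log (8 * d) + d * Real.log n)) < n := by
    have h1 : Filter.Tendsto (fun x : ℝ => (K : ℝ) * (2 * (Real.log (8 * d) / x +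
        d * (Real.log x / x)))) Filter.atTop (nhds (K * (2 * (0 + d * 0)))) :=
      ((((tendsto_const_nhds.div_atTop Filter.tendsto_id).add
        ((Real.isLittleO_log_id_atTop.tendsto_div_nhds_zero).const_mul _)).const_mul 2).const_mul _)
    have h2 := (h1.comp tendsto_natCast_atTop_atTop).eventually_lt_const
      (u := (1 : ℝ)) (by simp)
    filter_upwards [h2, Filter.eventually_gt_atTop 0] with n hn hn0
    have hn0' : (0 : ℝ) < n := by exact_mod_cast hn0
    have := mul_lt_mul_of_pos_right hn hn0'
    rw [one_mul] at this
    refine lt_of_eq_of_lt ?_ this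
    simp only [Function.comp]
    field_simp
  obtain ⟨n₁, hn₁⟩ := Filter.eventually_atTop.1 hsmall
  have hlog2 : 0 < Real.log 2 := Real.log_pos one_lt_two
  have hlogd : 0 ≤ Real.log (8 * d) := Real.log_nonneg (by linarith)
  -- `A + 1` keeps the constant positive even if `A = 0`; the ratio of logarithms absorbs `log (8d)`
  -- into `log N`, as `N ≥ 2`.
  refine ⟨max 2 (max n₁ (r + 1)), 2 * (A + 1) * d * (Real.log (8 * d) / Real.log 2 + 1),
    by positivity, fun n _ hn => ?_⟩
  have hn2 : 2 ≤ n := (le_max_left _ _).trans hn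
  have hnn₁ : n₁ ≤ n := ((le_max_left _ _).trans (le_max_right _ _)).trans hn
  have hnr : r < n := ((le_max_right _ _).trans (le_max_right _ _)).trans hn
  have hne := nonempty_torus_edgeSet hd hn2
  set N : ℝ := ((n ^ d : ℕ) : ℝ) with hN
  have hN2 : 2 ≤ N := by
    rw [hN]
    exact_mod_cast hn2.trans (Nat.le_self_pow (by omega) n)
  have hlogN : Real.log 2 ≤ Real.log N := Real.log_le_log two_pos hN2
  have hX : Real.log (8 * d * N) = Real.log (8 * d) + Real.log N :=
    Real.log_mul (by positivity) (by positivity)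
  have hlogNn : Real.log N = d * Real.log n := by rw [hN, Nat.cast_pow, Real.log_pow]
  have hX1 : 1 ≤ Real.log (8 * d * N) := by
    rw [Real.le_log_iff_exp_le (by positivity)]
    have := Real.exp_one_lt_d9
    nlinarith
  -- The scale `2 ^ (j + 1)` exceeds `log (8dN)`, hence `exp (-2 ^ (j + 1)) ≤ 1 / (8dN) ≤ 1 /
  -- (8|E|)`, but by at most a factor `2`.
  obtain ⟨j, hj1, hj2⟩ := exists_nat_pow_near hX1 one_lt_two
  have hj3 : (2 : ℝ) ^ (j + 1) ≤ 2 * Real.log (8 * d * N) := by rw [pow_succ']; linarith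
  have hfit : K * 2 ^ (j + 1) < n := by
    have h1 := hn₁ n hnn₁
    rw [← hlogNn, ← hX] at h1
    have h2 := (mul_le_mul_of_nonneg_left hj3 hK0.le).trans_lt h1
    exact_mod_cast h2
  have hEle : (Fintype.card (torus d n).edgeSet : ℝ) ≤ d * N := by
    rw [hN]; exact_mod_cast card_torus_edgeSet_le (d := d) (n := n)
  have hE : (0 : ℝ) < Fintype.card (torus d n).edgeSet := by exact_mod_cast Fintype.card_pos
  refine ⟨2 ^ (j + 1) * (A * Fintype.card (torus d n).edgeSet),
    fkMixingTime_le hp0 hp1 hq fun e => ?_, ?_⟩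
  · refine (torus_disagreement_pow_two_le hp0 hp1 hq hC h hK4 hKC hexp (hA n hnr) (j + 1) hfit
      e).trans ?_
    have h1 : 1 / (2 * (4 * (K : ℝ)) ^ (2 * d)) * (((2 : ℝ) ^ (j + 1)) ^ (2 * d))⁻¹ ≤ 1 := by
      refine mul_le_one₀ ?_ (by positivity) (inv_le_one_of_one_le₀
        (one_le_pow₀ (one_le_pow₀ one_le_two)))
      have hK1 : (1 : ℝ) ≤ 4 * K := by
        have : (4 : ℝ) ≤ K := by exact_mod_cast hK4
        linarith
      rw [div_le_one (by positivity)]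
      linarith [one_le_pow₀ hK1 (n := 2 * d)]
    calc _ ≤ 1 * Real.exp (-(2 : ℝ) ^ (j + 1)) :=
          mul_le_mul_of_nonneg_right h1 (Real.exp_pos _).le
      _ ≤ Real.exp (-Real.log (8 * d * N)) := by
          rw [one_mul]; exact Real.exp_le_exp.2 (neg_le_neg hj2.le)
      _ = 1 / (8 * (d * N)) := by
          rw [Real.exp_neg, Real.exp_log (by positivity), one_div, mul_assoc]
      _ ≤ _ := one_div_le_one_div_of_le (by positivity) (by linarith)
  · push_cast
    have h1 : Real.log (8 * d) ≤ Real.log (8 * d) / Real.log 2 * Real.log N := by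
      rw [div_mul_eq_mul_div, le_div_iff₀ hlog2]
      exact mul_le_mul_of_nonneg_left hlogN hlogd
    calc (2 : ℝ) ^ (j + 1) * (A * Fintype.card (torus d n).edgeSet)
        ≤ (2 * ((Real.log (8 * d) / Real.log 2 + 1) * Real.log N)) * ((A + 1) * (d * N)) := by
          have h2 : (2 : ℝ) ^ (j + 1) ≤
              2 * ((Real.log (8 * d) / Real.log 2 + 1) * Real.log N) := by
            refine hj3.trans ?_
            rw [hX]; linarith
          refine mul_le_mul h2 (mul_le_mul (by linarith) hEle hE.le (by positivity))
            (by positivity) (le_trans (by positivity) h2)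
      _ = _ := by ring

end Torus

end FK

end

theorem theorem1p1 (d : ℕ) (hd : 2 ≤ d) (p q : ℝ) (hp0 : 0 ≤ p) (hp1 : p ≤ 1) (hq : 1 ≤ q)
    (hWSM : FK.WeakSpatialMixing d p q) :
    ∃ C : ℝ, 0 < C ∧ ∀ (n : ℕ) [NeZero n], 2 ≤ n →
      (FK.fkMixingTime (FK.torus d n) ⊥ p q : ENNReal) ≤
        ENNReal.ofReal (C * ((n ^ d : ℕ) : ℝ) * Real.log ((n ^ d : ℕ) : ℝ)) := by
  obtain ⟨C, hC, hmix⟩ := hWSM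
  obtain ⟨n₀, A, hA, hlarge⟩ := FK.exists_torus_mixingTime_le hd hp0 hp1 hq hC hmix
  have hsmall : ∀ n : ℕ, ∃ t : ℕ, ∀ [NeZero n], 2 ≤ n →
      FK.fkMixingTime (FK.torus d n) ⊥ p q ≤ t := by
    intro n
    by_cases hn : 2 ≤ n
    · have : NeZero n := ⟨by omega⟩
      have := FK.nonempty_torus_edgeSet hd hn
      obtain ⟨t, ht⟩ := FK.exists_fkMixingTime_le (G := FK.torus d n) (ξ := ⊥) hp0 hp1 hq
      exact ⟨t, fun _ => ht⟩
    · exact ⟨0, fun h => absurd h hn⟩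
  choose T hT using hsmall
  have hlog2 : 0 < Real.log 2 := Real.log_pos one_lt_two
  -- The small tori are absorbed into the constant, since `N log N ≥ log 2`.
  set B : ℝ := ∑ n ∈ Finset.range n₀, (T n : ℝ) / Real.log 2 with hB
  have hB0 : 0 ≤ B := Finset.sum_nonneg fun n _ => by positivity
  refine ⟨A + B, by positivity, fun n _ hn => ?_⟩
  have hN : (2 : ℝ) ≤ ((n ^ d : ℕ) : ℝ) := by
    exact_mod_cast hn.trans (Nat.le_self_pow (by omega) n)
  set N : ℝ := ((n ^ d : ℕ) : ℝ)
  have hlogN : Real.log 2 ≤ Real.log N := Real.log_le_log two_pos hN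
  have hNlog : Real.log 2 ≤ N * Real.log N := by nlinarith
  suffices ∃ t : ℕ, FK.fkMixingTime (FK.torus d n) ⊥ p q ≤ t ∧
      (t : ℝ) ≤ (A + B) * N * Real.log N by
    obtain ⟨t, ht, htC⟩ := this
    refine (ENat.toENNReal_le.2 ht).trans ?_
    rw [ENat.toENNReal_coe, ← ENNReal.ofReal_natCast]
    exact ENNReal.ofReal_le_ofReal htC
  rcases le_or_gt n₀ n with hn₀ | hn₀
  · obtain ⟨t, ht, htA⟩ := hlarge n hn₀
    refine ⟨t, ht, htA.trans ?_⟩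
    have := mul_nonneg hB0 (hlog2.le.trans hNlog)
    linarith
  · refine ⟨T n, hT n hn, ?_⟩
    have h1 : (T n : ℝ) / Real.log 2 ≤ B :=
      Finset.single_le_sum (f := fun n => (T n : ℝ) / Real.log 2) (fun n _ => by positivity)
        (Finset.mem_range.2 hn₀)
    have h2 : (T n : ℝ) ≤ B * (N * Real.log N) := by
      rw [div_le_iff₀ hlog2] at h1
      exact h1.trans (mul_le_mul_of_nonneg_left hNlog hB0)
    have := mul_nonneg hA.le (hlog2.le.trans hNlog)
    linarith
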